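/- Conventions. A topological groupoid $G$ is a groupoid, identified with its set of arrows and with objects identified with unit arrows ($G^{(0)}\subset G$), equipped with a locally compact Hausdorff topology for which inversion and the partial multiplication are continuous; $G^{(0)}$ and the set $G^{(2)}$ of composable pairs $(g,h)$, $s(g)=t(h)$, carry the subspace topologies. A Haar system on $G$ is a family $\{\mu^x : x\in G^{(0)}\}$ of regular Radon measures on $G$ with $\operatorname{supp}\mu^x=G^x:=\{g : t(g)=x\}$, such that for all $f\in C_c(G)$ the function $x\mapsto\int f\,d\mu^x$ is continuous on $G^{(0)}$ and $\int f(h)\,d\mu^{t(g)}(h)=\int f(gh)\,d\mu^{s(g)}(h)$ for every $g\in G$. A 2-cocycle is a continuous map $\sigma:G^{(2)}\to\mathbb T$ with $\sigma(g,h)\sigma(gh,k)=\sigma(g,hk)\sigma(h,k)$ whenever $(g,h),(h,k)\in G^{(2)}$. $C_c(G,\sigma)$ is the space of continuous compactly supported functions $G\to\mathbb C$ with $$(f*g)(x)=\int_G f(xy)\,g(y^{-1})\,\sigma(xy,y^{-1})\,d\mu^{s(x)}(y),\qquad f^*(x)=\overline{f(x^{-1})\,\sigma(x,x^{-1})},$$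 $$\|f\|_I=\max\Bigl\{\sup_{x\in G^{(0)}}\int_G|f(g)|\,d\mu^x(g),\ \sup_{x\in G^{(0)}}\int_G|f(g^{-1})|\,d\mu^x(g)\Bigr\};$$ its inductive limit topology is the finest locally convex vector space topology for which the inclusions of the spaces $C_K(G)$ ($K\subset G$ compact, sup norm) are continuous. A sequence $(\mathcal W_n)_{n\ge 0}$ of covers of a set is normal if for every $n$ and every $U\in\mathcal W_{n+1}$ the union of all members of $\mathcal W_{n+1}$ that meet $U$ is contained in some member of $\mathcal W_n$. A continuous map is proper if preimages of closed compact sets are compact. Theorem. Let $G$ be a $\sigma$-compact topological groupoid with a Haar system $\{\mu^x\}$ and a 2-cocycle $\sigma$, and let $(\mathcal W^0_n)_{n\ge0}$ and $(\mathcal W^1_n)_{n\ge0}$ be normal sequences of open covers of $G^{(0)}$ and of $G$, respectively. Then there is a pseudo-metric $d$ on $G$ with the following properties. Let $G_\alpha$ be the metric quotient of $(G,d)$, obtained by identifying points at distance $0$. 1. $G_\alpha$, with its metric topology, has the structure of a second countable (locally compact Hausdorff) topological groupoid for which the quotient map $q_\alpha: G\to G_\alpha$ is a groupoid morphism. The maps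 $\mathrm{id}_G: G\to(G,d)$, $p_\alpha:(G,d)\to G_\alpha$ and $q_\alpha=p_\alpha\circ\mathrm{id}_G$ are continuous and proper. 2. For every $n\ge0$, the preimage under $q_\alpha$ of every ball of radius $2^{-n}$ in $G_\alpha$ is contained in a member of $\mathcal W^1_n$, and the preimage in $G^{(0)}$ of every ball of radius $2^{-n}$ in $G_\alpha^{(0)}$ is contained in a member of $\mathcal W^0_n$. 3. $G_\alpha$ has a Haar system $\{\mu_\alpha^y\}$ and a 2-cocycle $\sigma_\alpha$ induced from $G$: $(q_\alpha)_*\mu^x=\mu_\alpha^{q_\alpha(x)}$ for all $x\in G^{(0)}$, and $\sigma(g,h)=\sigma_\alpha(q_\alpha(g),q_\alpha(h))$ for all $(g,h)\in G^{(2)}$. 4. The pullback $q_\alpha^*: C_c(G_\alpha,\sigma_\alpha)\to C_c(G,\sigma)$, $f\mapsto f\circ q_\alpha$, is a $*$-morphism of topological $*$-algebras: it is linear, $q_\alpha^*(f*g)=q_\alpha^*f*q_\alpha^*g$ and $q_\alpha^*(f^*)=(q_\alpha^*f)^*$, and it is continuous both for the I-norms and for the inductive limit topologies. -/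

import Mathlib

open MeasureTheory Topology Set
open scoped CompactlySupported ENNReal

/-! ## Groupoids, presented by their set of arrows -/

/-- A groupoid (small category with all arrows invertible), presented by its set `G` of arrows.
Objects are identified with their unit arrows; `mul g h` is defined iff `src g = tgt h`. -/
class ArrowGroupoid (G : Type*) where
  src : G → G
  tgt : G → G
  inv : G → G
  mul : (g h : G) → src g = tgt h → G
  src_src : ∀ g, src (src g) = src g
  tgt_src : ∀ g, tgt (src g) = src g
  src_tgt : ∀ g, src (tgt g) = tgt g
  tgt_tgt : ∀ g, tgt (tgt g) = tgt g
  src_mul : ∀ g h e, src (mul g h e) = src h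
  tgt_mul : ∀ g h e, tgt (mul g h e) = tgt g
  assoc : ∀ g h k (e : src g = tgt h) (e' : src h = tgt k),
    mul (mul g h e) k ((src_mul g h e).trans e') = mul g (mul h k e') (e.trans (tgt_mul h k e').symm)
  mul_src : ∀ g, mul g (src g) (tgt_src g).symm = g
  tgt_mul_self : ∀ g, mul (tgt g) g (src_tgt g) = g
  src_inv : ∀ g, src (inv g) = tgt g
  tgt_inv : ∀ g, tgt (inv g) = src g
  mul_inv_self : ∀ g, mul g (inv g) (tgt_inv g).symm = tgt g
  inv_mul_self : ∀ g, mul (inv g) g (src_inv g) = src g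

namespace ArrowGroupoid

/-- The object space, as the subspace of unit arrows. -/
abbrev Obj (G : Type*) [ArrowGroupoid G] : Type _ := {x : G // src x = x}

/-- The composable pairs. -/
abbrev Comp (G : Type*) [ArrowGroupoid G] : Type _ := {p : G × G // src p.1 = tgt p.2}

section
variable {G H : Type*} [ArrowGroupoid G] [ArrowGroupoid H]

def srcObj (g : G) : Obj G := ⟨src g, src_src g⟩

def tgtObj (g : G) : Obj G := ⟨tgt g, src_tgt g⟩

open Classical in
/-- The function `h ↦ f(gh)`, set to `0` where `gh` is not defined. -/
noncomputable def leftTranslate (g : G) (f : G → ℂ) (h : G) : ℂ :=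
  if e : src g = tgt h then f (mul g h e) else 0

theorem inv_inv_arrow (g : G) : inv (inv g) = g := by
  have h1 := assoc (inv (inv g)) (inv g) g (src_inv _) (src_inv _)
  have h2 : mul (mul (inv (inv g)) (inv g) (src_inv _)) g
      ((src_mul _ _ _).trans (src_inv _)) = g := by
    have := tgt_mul_self g
    convert this using 2
    rw [inv_mul_self, src_inv]
  have h3 : mul (inv (inv g)) (mul (inv g) g (src_inv _))
      ((src_inv _).trans (tgt_mul _ _ _).symm) = inv (inv g) := by
    have := mul_src (inv (inv g))
    convert this using 2
    rw [inv_mul_self, src_inv, tgt_inv]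
  rw [← h3, ← h1, h2]

theorem mul_mul_inv_arrow (x y : G) (e : src x = tgt y) :
    mul (mul x y e) (inv y) ((src_mul x y e).trans (tgt_inv y).symm) = x := by
  rw [assoc x y (inv y) e (tgt_inv y).symm]
  have := mul_src x
  convert this using 2
  rw [mul_inv_self, e]

/-- Functors between groupoids, as maps on arrows. -/
structure IsHom (q : G → H) : Prop where
  map_src : ∀ g, q (src g) = src (q g)
  map_tgt : ∀ g, q (tgt g) = tgt (q g)
  map_mul : ∀ g h (e : src g = tgt h),
    q (mul g h e) = mul (q g) (q h) (by rw [← map_src, ← map_tgt, e])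

/-- The map induced on objects by a functor. -/
def IsHom.obj {q : G → H} (hq : IsHom q) (x : Obj G) : Obj H :=
  ⟨q x.1, by rw [← hq.map_src, x.2]⟩

/-- The map induced on composable pairs by a functor. -/
def IsHom.comp {q : G → H} (hq : IsHom q) (p : Comp G) : Comp H :=
  ⟨(q p.1.1, q p.1.2), by rw [← hq.map_src, ← hq.map_tgt, p.2]⟩

end

end ArrowGroupoid

open ArrowGroupoid

/-- Topological groupoids: locally compact Hausdorff, with continuous inverse and partial
multiplication. -/
class IsTopGroupoid (G : Type*) [TopologicalSpace G] [ArrowGroupoid G] : Prop where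
  t2 : T2Space G
  locallyCompact : LocallyCompactSpace G
  continuous_inv : Continuous (inv : G → G)
  continuous_mul : Continuous fun p : Comp G => mul p.1.1 p.1.2 p.2

attribute [instance] IsTopGroupoid.t2 IsTopGroupoid.locallyCompact

/-- A Haar system: regular Borel measures `μ^x` with support exactly the set of arrows with
target `x`, continuous in `x` and left invariant. -/
structure HaarSystem (G : Type*) [TopologicalSpace G] [MeasurableSpace G] [BorelSpace G]
    [ArrowGroupoid G] where
  meas : Obj G → Measure G
  regular : ∀ x, (meas x).Regular
  support_eq : ∀ x, (meas x).support = {g | tgt g = x.1}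
  continuous_integral : ∀ f : C_c(G, ℂ), Continuous fun x => ∫ g, f g ∂(meas x)
  left_invariant : ∀ (g : G) (f : C_c(G, ℂ)),
    ∫ h, f h ∂(meas (tgtObj g)) = ∫ h, leftTranslate g f h ∂(meas (srcObj g))

/-- Continuous circle-valued 2-cocycles. -/
structure TwoCocycle (G : Type*) [TopologicalSpace G] [ArrowGroupoid G] where
  toFun : Comp G → Circle
  continuous_toFun : Continuous toFun
  cocycle : ∀ g h k (e : src g = tgt h) (e' : src h = tgt k),
    toFun ⟨(g, h), e⟩ * toFun ⟨(mul g h e, k), (src_mul g h e).trans e'⟩ =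
      toFun ⟨(g, mul h k e'), e.trans (tgt_mul h k e').symm⟩ * toFun ⟨(h, k), e'⟩

/-! ## The twisted convolution algebra -/

section Algebra

variable {G : Type*} [TopologicalSpace G] [ArrowGroupoid G]

section Formulas

open Classical in
/-- The integrand `f(xy) g(y⁻¹) σ(xy, y⁻¹)` of the convolution, set to `0` where `xy` is not
defined (a null set for `μ^{s(x)}`). -/
noncomputable def convIntegrand (σ : TwoCocycle G) (f g : G → ℂ) (x y : G) : ℂ :=
  if e : src x = tgt y then
    f (mul x y e) * g (inv y) *
      (σ.toFun ⟨(mul x y e, inv y), (src_mul x y e).trans (tgt_inv y).symm⟩ : ℂ)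
  else 0

noncomputable def convFun [MeasurableSpace G] [BorelSpace G] (μ : HaarSystem G)
    (σ : TwoCocycle G) (f g : G → ℂ) (x : G) : ℂ :=
  ∫ y, convIntegrand σ f g x y ∂(μ.meas (srcObj x))

noncomputable def adjFun (σ : TwoCocycle G) (f : G → ℂ) (x : G) : ℂ :=
  starRingEnd ℂ (f (inv x) * (σ.toFun ⟨(x, inv x), (tgt_inv x).symm⟩ : ℂ))

end Formulas

section Closure

theorem HaarSystem.ae_tgt [MeasurableSpace G] [BorelSpace G] (μ : HaarSystem G) (x : Obj G) : ∀ᵐ g ∂(μ.meas x), tgt g = x.1 := by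
  have := μ.regular x
  have h := Measure.support_mem_ae_of_innerRegularWRT_isCompact_isOpen
    (μ := μ.meas x) Measure.Regular.innerRegular
  rw [μ.support_eq] at h
  exact h

variable [IsTopGroupoid G]

theorem continuous_tgt : Continuous (tgt : G → G) := by
  have h : (tgt : G → G) = fun g => mul g (inv g) (tgt_inv g).symm := by
    funext g; exact (mul_inv_self g).symm
  rw [h]
  exact IsTopGroupoid.continuous_mul.comp
    (Continuous.subtype_mk (continuous_id.prodMk IsTopGroupoid.continuous_inv)
      fun g => (tgt_inv g).symm)

theorem continuous_src : Continuous (src : G → G) := by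
  have h : (src : G → G) = fun g => mul (inv g) g (src_inv g) := by
    funext g; exact (inv_mul_self g).symm
  rw [h]
  exact IsTopGroupoid.continuous_mul.comp
    (Continuous.subtype_mk (IsTopGroupoid.continuous_inv.prodMk continuous_id) src_inv)

theorem isClosed_comp : IsClosed {p : G × G | src p.1 = tgt p.2} :=
  isClosed_eq (continuous_src.comp continuous_fst) (continuous_tgt.comp continuous_snd)

theorem HasCompactSupport.comp_inv_arrow {f : G → ℂ} (hf : HasCompactSupport f) :
    HasCompactSupport fun x => f (inv x) := by
  refine HasCompactSupport.intro (hf.isCompact.image IsTopGroupoid.continuous_inv) ?_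
  intro x hx
  by_contra h
  exact hx ⟨inv x, subset_tsupport _ h, inv_inv_arrow x⟩

theorem continuous_adjFun (σ : TwoCocycle G) (f : C_c(G, ℂ)) : Continuous (adjFun σ f) := by
  unfold adjFun
  refine Complex.continuous_conj.comp ((f.continuous.comp IsTopGroupoid.continuous_inv).mul
    (continuous_subtype_val.comp (σ.continuous_toFun.comp ?_)))
  exact Continuous.subtype_mk (continuous_id.prodMk IsTopGroupoid.continuous_inv) _

theorem hasCompactSupport_adjFun (σ : TwoCocycle G) (f : C_c(G, ℂ)) :
    HasCompactSupport (adjFun σ f) := by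
  refine f.hasCompactSupport.comp_inv_arrow.mono' ?_
  refine (fun x hx => subset_tsupport _ ?_)
  intro h
  have h : f (inv x) = 0 := h
  exact hx (by simp [adjFun, h])

/-- Extension of a function on a closed set to a compactly supported continuous one. -/
theorem exists_extend_compactly_supported {X : Type*} [TopologicalSpace X] [T2Space X]
    [LocallyCompactSpace X] {A K : Set X} (hA : IsClosed A) (hK : IsCompact K) {u : X → ℂ}
    (hu : ContinuousOn u A) (h0 : ∀ x ∈ A, x ∉ K → u x = 0) :
    ∃ φ : C_c(X, ℂ), ∀ x ∈ A, φ x = u x := by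
  classical
  obtain ⟨L', hL', hKL'⟩ := exists_compact_superset hK
  obtain ⟨L, hL, hL'L⟩ := exists_compact_superset hL'
  obtain ⟨χ, hχ1, hχ0, -, -⟩ := exists_continuous_one_zero_of_isCompact (X := X) hK
    (t := (interior L')ᶜ) isOpen_interior.isClosed_compl
    (by rw [disjoint_compl_right_iff_subset]; exact hKL')
  have : CompactSpace L := isCompact_iff_compactSpace.mp hL
  let B : Set L := Subtype.val ⁻¹' A
  have hB : IsClosed B := hA.preimage continuous_subtype_val
  have hc : Continuous fun z : B => u z.1.1 :=
    hu.comp_continuous (continuous_subtype_val.comp continuous_subtype_val) fun z => z.2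
  obtain ⟨ψ, hψ⟩ := ContinuousMap.exists_restrict_eq hB (⟨fun z : B => u z.1.1, hc⟩ : C(B, ℂ))
  have hψ' : ∀ x (hx : x ∈ L), x ∈ A → ψ ⟨x, hx⟩ = u x := by
    intro x hx hxA
    exact DFunLike.congr_fun hψ (⟨⟨x, hx⟩, hxA⟩ : B)
  let φ : X → ℂ := fun x => if hx : x ∈ L then (χ x : ℂ) * ψ ⟨x, hx⟩ else 0
  have hz : ∀ x, x ∉ L' → φ x = 0 := by
    intro x hx
    have : χ x = 0 := hχ0 (fun h => hx (interior_subset h))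
    simp only [φ, this]
    split_ifs <;> simp
  have hφ : Continuous φ := by
    rw [continuous_iff_continuousAt]
    intro x
    by_cases hx : x ∈ L'
    · have hxL : x ∈ interior L := hL'L hx
      have hon : ContinuousOn φ L := by
        rw [continuousOn_iff_continuous_domRestrict]
        have : L.domRestrict φ = fun z : L => (χ z.1 : ℂ) * ψ z := by
          funext z
          simp [φ, Set.domRestrict]
        rw [this]
        fun_prop
      exact hon.continuousAt (mem_interior_iff_mem_nhds.mp hxL)
    · have : φ =ᶠ[𝓝 x] fun _ => 0 := by
        filter_upwards [hL'.isClosed.isOpen_compl.mem_nhds hx] with y hy using hz y hy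
      exact continuousAt_const.congr this.symm
  refine ⟨⟨⟨φ, hφ⟩, HasCompactSupport.intro hL' hz⟩, ?_⟩
  intro x hxA
  change φ x = u x
  by_cases hxK : x ∈ K
  · have hxL : x ∈ L := interior_subset (hL'L (interior_subset (hKL' hxK)))
    have h1 : χ x = 1 := hχ1 hxK
    simp [φ, hxL, h1, hψ' x hxL hxA]
  · by_cases hxL : x ∈ L
    · simp [φ, hxL, hψ' x hxL hxA, h0 x hxA hxK]
    · simp [φ, hxL, h0 x hxA hxK]

theorem continuousOn_convIntegrand (σ : TwoCocycle G) (f g : C_c(G, ℂ)) :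
    ContinuousOn (fun p : G × G => convIntegrand σ f g p.1 p.2) {p | src p.1 = tgt p.2} := by
  rw [continuousOn_iff_continuous_domRestrict]
  have : {p : G × G | src p.1 = tgt p.2}.domRestrict (fun p => convIntegrand σ f g p.1 p.2) =
      fun p : Comp G => f (mul p.1.1 p.1.2 p.2) * g (inv p.1.2) *
        (σ.toFun ⟨(mul p.1.1 p.1.2 p.2, inv p.1.2),
          (src_mul _ _ p.2).trans (tgt_inv _).symm⟩ : ℂ) := by
    funext p
    have hp : src p.1.1 = tgt p.1.2 := p.2
    simp [Set.domRestrict, convIntegrand, hp]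
  rw [this]
  have hm : Continuous fun p : Comp G => mul p.1.1 p.1.2 p.2 := IsTopGroupoid.continuous_mul
  have hi : Continuous fun p : Comp G => inv p.1.2 :=
    IsTopGroupoid.continuous_inv.comp (continuous_snd.comp continuous_subtype_val)
  exact ((f.continuous.comp hm).mul (g.continuous.comp hi)).mul
    (continuous_subtype_val.comp (σ.continuous_toFun.comp
      (Continuous.subtype_mk (hm.prodMk hi) _)))

variable [MeasurableSpace G] [BorelSpace G]

theorem continuous_convFun (μ : HaarSystem G) (σ : TwoCocycle G) (f g : C_c(G, ℂ)) :
    Continuous (convFun μ σ f g) := by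
  have hgi := g.hasCompactSupport.comp_inv_arrow
  set K : Set G := tsupport fun x => g (inv x) with hKdef
  have hK : IsCompact K := hgi.isCompact
  have hzero : ∀ x y, y ∉ K → convIntegrand σ f g x y = 0 := by
    intro x y hy
    have : g (inv y) = 0 := by
      by_contra h
      exact hy (subset_tsupport (fun x => g (inv x)) h)
    unfold convIntegrand
    split_ifs <;> simp [this]
  have hfib : ∀ x : G, ∃ φ : C_c(G, ℂ), ∀ y ∈ {y | src x = tgt y},
      φ y = convIntegrand σ f g x y := by
    intro x
    refine exists_extend_compactly_supported (isClosed_eq continuous_const continuous_tgt) hK ?_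
      (fun y _ hy => hzero x y hy)
    exact (continuousOn_convIntegrand σ f g).comp (f := fun y => (x, y))
      (by fun_prop) (fun y hy => hy)
  choose φ hφ using hfib
  have hint : ∀ x, convFun μ σ f g x = ∫ y, φ x y ∂(μ.meas (srcObj x)) := by
    intro x
    refine integral_congr_ae ?_
    filter_upwards [μ.ae_tgt (srcObj x)] with y hy
    exact (hφ x y hy.symm).symm
  rw [continuous_iff_continuousAt]
  intro x₀
  -- a nonnegative compactly supported function dominating the relevant compact set
  set K₂ : Set G := K ∪ tsupport (φ x₀) with hK₂
  have hK₂c : IsCompact K₂ := hK.union (φ x₀).hasCompactSupport.isCompact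
  obtain ⟨χ, hχ1, -, hχs, hχr⟩ := exists_continuous_one_zero_of_isCompact (X := G) hK₂c
    (t := ∅) isClosed_empty (disjoint_empty _)
  have hχc : HasCompactSupport fun y => (χ y : ℂ) := hχs.comp_left (g := Complex.ofReal) (by simp)
  let χc : C_c(G, ℂ) := ⟨⟨fun y => (χ y : ℂ), by fun_prop⟩, hχc⟩
  have hsrc : Continuous (srcObj : G → Obj G) := Continuous.subtype_mk continuous_src _
  have hI : ∀ x, ∫ y, χc y ∂(μ.meas x) = ((∫ y, χ y ∂(μ.meas x) : ℝ) : ℂ) := by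
    intro x
    exact integral_ofReal
  have hχint : Continuous fun x : Obj G => ∫ y, χ y ∂(μ.meas x) := by
    have h := Complex.continuous_re.comp (μ.continuous_integral χc)
    refine h.congr ?_
    intro x
    simp [Function.comp, hI]
  set M : ℝ := (∫ y, χ y ∂(μ.meas (srcObj x₀))) + 1 with hM
  have hMev : ∀ᶠ x in 𝓝 x₀, ∫ y, χ y ∂(μ.meas (srcObj x)) < M :=
    ((hχint.comp hsrc).continuousAt (x := x₀)).eventually (gt_mem_nhds (by simp [hM]))
  have hMpos : 0 < M := by
    have : 0 ≤ ∫ y, χ y ∂(μ.meas (srcObj x₀)) := integral_nonneg fun y => (hχr y).1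
    linarith
  rw [ContinuousAt, hint x₀, Metric.tendsto_nhds]
  intro ε hε
  set δ : ℝ := ε / (2 * M) with hδ
  have hδpos : 0 < δ := by positivity
  have hcont2 := ((μ.continuous_integral (φ x₀)).comp hsrc).continuousAt (x := x₀)
  have hev2 := Metric.tendsto_nhds.mp hcont2 (ε / 2) (by positivity)
  -- the integrand is uniformly close to that at `x₀`
  have hunif : ∀ᶠ x in 𝓝 x₀, ∀ y ∈ K₂, src x = tgt y →
      ‖convIntegrand σ f g x y - φ x₀ y‖ < δ := by
    have hcl : ∀ y ∈ K₂, ∀ᶠ p : G × G in 𝓝 x₀ ×ˢ 𝓝 y, src p.1 = tgt p.2 →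
        ‖convIntegrand σ f g p.1 p.2 - φ x₀ p.2‖ < δ := by
      intro y _
      rw [← nhds_prod_eq]
      by_cases he : src x₀ = tgt y
      · have hc : ContinuousWithinAt
            (fun p : G × G => ‖convIntegrand σ f g p.1 p.2 - φ x₀ p.2‖)
            {p | src p.1 = tgt p.2} (x₀, y) := by
          refine ((continuousOn_convIntegrand σ f g (x₀, y) he).sub ?_).norm
          exact ((φ x₀).continuous.comp continuous_snd).continuousWithinAt
        have h0 : ‖convIntegrand σ f g x₀ y - φ x₀ y‖ < δ := by
          rw [hφ x₀ y he]; simpa using hδpos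
        exact eventually_nhdsWithin_iff.mp (hc.eventually (gt_mem_nhds h0))
      · filter_upwards [isClosed_comp.isOpen_compl.mem_nhds
          (show (x₀, y) ∈ {p : G × G | src p.1 = tgt p.2}ᶜ from he)] with p hp h
        exact absurd h hp
    exact hK₂c.eventually_forall_of_forall_eventually (fun y hy => by
      have := hcl y hy
      rw [← nhds_prod_eq] at this
      exact this)
  filter_upwards [hMev, hev2, hunif] with x hx1 hx2 hx3
  have := μ.regular (srcObj x)
  have hφi : ∀ z, Integrable (φ z) (μ.meas (srcObj x)) := fun z =>
    (φ z).continuous.integrable_of_hasCompactSupport (φ z).hasCompactSupport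
  have hχi : Integrable (fun y => χ y) (μ.meas (srcObj x)) :=
    χ.continuous.integrable_of_hasCompactSupport hχs
  have hbound : ‖∫ y, (φ x y - φ x₀ y) ∂(μ.meas (srcObj x))‖ ≤
      ∫ y, δ * χ y ∂(μ.meas (srcObj x)) := by
    refine norm_integral_le_of_norm_le (hχi.const_mul δ) ?_
    filter_upwards [μ.ae_tgt (srcObj x)] with y hy
    have hy' : src x = tgt y := hy.symm
    rw [hφ x y hy']
    by_cases hyK : y ∈ K₂
    · have h1 : χ y = 1 := hχ1 hyK
      rw [h1, mul_one]
      exact (hx3 y hyK hy').le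
    · have h1 : convIntegrand σ f g x y = 0 := hzero x y fun h => hyK (Or.inl h)
      have h2 : φ x₀ y = 0 := image_eq_zero_of_notMem_tsupport fun h => hyK (Or.inr h)
      rw [h1, h2]
      simpa using mul_nonneg hδpos.le (hχr y).1
  rw [integral_const_mul] at hbound
  have hb2 : δ * ∫ y, χ y ∂(μ.meas (srcObj x)) ≤ ε / 2 := by
    calc δ * ∫ y, χ y ∂(μ.meas (srcObj x)) ≤ δ * M := by gcongr
      _ = ε / 2 := by rw [hδ]; field_simp
  rw [hint x]
  rw [integral_sub (hφi x) (hφi x₀)] at hbound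
  rw [dist_eq_norm] at hx2 ⊢
  calc ‖(∫ y, φ x y ∂(μ.meas (srcObj x))) - ∫ y, φ x₀ y ∂(μ.meas (srcObj x₀))‖
      = ‖((∫ y, φ x y ∂(μ.meas (srcObj x))) - ∫ y, φ x₀ y ∂(μ.meas (srcObj x))) +
        ((∫ y, φ x₀ y ∂(μ.meas (srcObj x))) - ∫ y, φ x₀ y ∂(μ.meas (srcObj x₀)))‖ := by
          congr 1; ring
    _ ≤ _ := norm_add_le _ _
    _ < ε / 2 + ε / 2 := add_lt_add_of_le_of_lt (hbound.trans hb2) hx2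
    _ = ε := by ring

theorem hasCompactSupport_convFun (μ : HaarSystem G) (σ : TwoCocycle G) (f g : C_c(G, ℂ)) :
    HasCompactSupport (convFun μ σ f g) := by
  have hc : IsCompact ((Subtype.val : Comp G → G × G) ⁻¹' (tsupport f ×ˢ tsupport g)) :=
    (IsClosed.isClosedEmbedding_subtypeVal isClosed_comp).isCompact_preimage
      (f.hasCompactSupport.isCompact.prod g.hasCompactSupport.isCompact)
  refine HasCompactSupport.intro (hc.image IsTopGroupoid.continuous_mul) ?_
  intro x hx
  have : ∀ y, convIntegrand σ f g x y = 0 := by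
    intro y
    unfold convIntegrand
    split_ifs with e
    · by_contra h
      refine hx ⟨⟨(mul x y e, inv y), (src_mul x y e).trans (tgt_inv y).symm⟩, ⟨?_, ?_⟩,
        mul_mul_inv_arrow x y e⟩
      · exact subset_tsupport _ fun h' => h (by simp [h'])
      · exact subset_tsupport _ fun h' => h (by simp [h'])
    · rfl
  simp [convFun, this]

end Closure

variable [IsTopGroupoid G]

/-- The twisted convolution `(f * g)(x) = ∫ f(xy) g(y⁻¹) σ(xy, y⁻¹) dμ^{s(x)}(y)` on `C_c(G)`. -/
noncomputable def conv [MeasurableSpace G] [BorelSpace G] (μ : HaarSystem G) (σ : TwoCocycle G)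
    (f g : C_c(G, ℂ)) : C_c(G, ℂ) :=
  ⟨⟨convFun μ σ f g, continuous_convFun μ σ f g⟩, hasCompactSupport_convFun μ σ f g⟩

/-- The twisted adjoint `f^*(x) = conj (f(x⁻¹) σ(x, x⁻¹))` on `C_c(G)`. -/
noncomputable def adj (σ : TwoCocycle G) (f : C_c(G, ℂ)) : C_c(G, ℂ) :=
  ⟨⟨adjFun σ f, continuous_adjFun σ f⟩, hasCompactSupport_adjFun σ f⟩


/-- The I-norm
`max (sup_x ∫ |f(g)| dμ^x(g)) (sup_x ∫ |f(g⁻¹)| dμ^x(g))`, with values in `[0, ∞]`. -/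
noncomputable def iNorm [MeasurableSpace G] [BorelSpace G] (μ : HaarSystem G)
    (f : C_c(G, ℂ)) : ℝ≥0∞ :=
  max (⨆ x : Obj G, ∫⁻ g, ‖f g‖ₑ ∂(μ.meas x)) (⨆ x : Obj G, ∫⁻ g, ‖f (inv g)‖ₑ ∂(μ.meas x))

end Algebra

/-- The inductive limit topology on `C_c(X)`: the finest locally convex vector space topology for
which every inclusion `C_K(X) → C_c(X)`, with `K` compact and `C_K(X)` carrying the topology of
the sup norm, is continuous. -/
@[reducible] noncomputable def indLimTopology (X : Type*) [TopologicalSpace X] : TopologicalSpace C_c(X, ℂ) :=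
  sInf {τ | @IsTopologicalAddGroup _ τ _ ∧ @ContinuousSMul ℂ _ _ _ τ ∧
    @LocallyConvexSpace ℝ _ _ _ _ _ τ ∧
    ∀ K : Set X, IsCompact K → @Continuous {f : C_c(X, ℂ) // tsupport f ⊆ K} _
      (TopologicalSpace.induced (fun f => f.1.toBoundedContinuousFunction) inferInstance) τ
      Subtype.val}

/-! ## Morphisms -/

/-- Proper continuous maps. For maps into a Hausdorff space this says that preimages of compact
sets are compact; for a target that is only pseudo-metric, compact sets need not be closed, and one
has to restrict to closed ones. -/
def IsProperCont {X Y : Type*} [TopologicalSpace X] [TopologicalSpace Y] (f : X → Y) : Prop :=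
  Continuous f ∧ ∀ K : Set Y, IsClosed K → IsCompact K → IsCompact (f ⁻¹' K)

theorem IsProperCont.hasCompactSupport_comp {X Y : Type*} [TopologicalSpace X] [TopologicalSpace Y]
    {q : X → Y} (hq : IsProperCont q) (f : C_c(Y, ℂ)) : HasCompactSupport (f ∘ q) := by
  have hK := hq.2 (tsupport f) (isClosed_tsupport f) f.hasCompactSupport
  have hc : IsClosed (q ⁻¹' tsupport f) := (isClosed_tsupport f).preimage hq.1
  refine hK.of_isClosed_subset (isClosed_tsupport _) (closure_minimal ?_ hc)
  intro x hx
  exact subset_tsupport f hx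

/-- The pullback `f ↦ f ∘ q` along a proper continuous map. -/
noncomputable def pullback {X Y : Type*} [TopologicalSpace X] [TopologicalSpace Y] {q : X → Y}
    (hq : IsProperCont q) : C_c(Y, ℂ) →ₗ[ℂ] C_c(X, ℂ) where
  toFun f := ⟨⟨f ∘ q, f.continuous.comp hq.1⟩, hq.hasCompactSupport_comp f⟩
  map_add' _ _ := rfl
  map_smul' _ _ := rfl

section Morphisms

variable {G H : Type*} [TopologicalSpace G] [MeasurableSpace G] [BorelSpace G] [ArrowGroupoid G]
  [TopologicalSpace H] [MeasurableSpace H] [BorelSpace H] [ArrowGroupoid H]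

/-- The functor `q` carries the Haar system of `G` to that of `H`. -/
def HaarPreserving {q : G → H} (hq : IsHom q) (μ : HaarSystem G) (ν : HaarSystem H) : Prop :=
  ∀ x : Obj G, (μ.meas x).map q = ν.meas (hq.obj x)

/-- The functor `q` pulls the cocycle of `H` back to that of `G`. -/
def CocyclePreserving {q : G → H} (hq : IsHom q) (σ : TwoCocycle G) (τ : TwoCocycle H) : Prop :=
  ∀ p : Comp G, σ.toFun p = τ.toFun (hq.comp p)

variable [IsTopGroupoid G] [IsTopGroupoid H]

/-- A linear map `C_c(H, τ) → C_c(G, σ)` that is a `*`-morphism for the twisted convolution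
products and adjoints, continuous both for the I-norms and for the inductive limit topologies. -/
structure IsStarMorphism (ν : HaarSystem H) (τ : TwoCocycle H) (μ : HaarSystem G)
    (σ : TwoCocycle G) (F : C_c(H, ℂ) →ₗ[ℂ] C_c(G, ℂ)) : Prop where
  map_conv : ∀ f g, F (conv ν τ f g) = conv μ σ (F f) (F g)
  map_adj : ∀ f, F (adj τ f) = adj σ (F f)
  continuous_iNorm : ∀ f, ∀ ε > 0, ∃ δ > 0, ∀ g, iNorm ν (g - f) < δ → iNorm μ (F g - F f) < ε
  continuous_indLim : Continuous[indLimTopology H, indLimTopology G] F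

end Morphisms

/-! ## Normal sequences of covers and metric quotients -/

/-- `𝒰` is a cover of `X` by open sets. -/
def IsOpenCovering {X : Type*} [TopologicalSpace X] (𝒰 : Set (Set X)) : Prop :=
  (∀ U ∈ 𝒰, IsOpen U) ∧ ⋃₀ 𝒰 = univ

/-- The star of `A` against `𝒰`. -/
def starOf {X : Type*} (A : Set X) (𝒰 : Set (Set X)) : Set X := ⋃₀ {U ∈ 𝒰 | (U ∩ A).Nonempty}

/-- `𝒰` star refines `𝒱`. -/
def StarRefines {X : Type*} (𝒰 𝒱 : Set (Set X)) : Prop := ∀ U ∈ 𝒰, ∃ V ∈ 𝒱, starOf U 𝒰 ⊆ V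

/-- A normal sequence of open covers. -/
def IsNormalSeq {X : Type*} [TopologicalSpace X] (𝒲 : ℕ → Set (Set X)) : Prop :=
  (∀ n, IsOpenCovering (𝒲 n)) ∧ ∀ n, StarRefines (𝒲 (n + 1)) (𝒲 n)

/-- The set `G` with the topology of the pseudo-metric `d`. -/
def WithPseudoMetric {G : Type*} (_d : PseudoMetricSpace G) : Type _ := G

instance {G : Type*} (d : PseudoMetricSpace G) : PseudoMetricSpace (WithPseudoMetric d) := d

/-- The metric quotient of `(G, d)`, identifying points at distance `0`. -/
def MetricQuotient {G : Type*} (d : PseudoMetricSpace G) : Type _ :=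
  SeparationQuotient (WithPseudoMetric d)

instance {G : Type*} (d : PseudoMetricSpace G) : MetricSpace (MetricQuotient d) :=
  inferInstanceAs (MetricSpace (SeparationQuotient (WithPseudoMetric d)))

instance {G : Type*} (d : PseudoMetricSpace G) : MeasurableSpace (MetricQuotient d) := borel _

instance {G : Type*} (d : PseudoMetricSpace G) : BorelSpace (MetricQuotient d) := ⟨rfl⟩

/-- The identity `G → (G, d)`. -/
def toPseudo {G : Type*} (d : PseudoMetricSpace G) : G → WithPseudoMetric d := fun g => g

/-- The quotient map `(G, d) → G_d`. -/
def metricProj {G : Type*} (d : PseudoMetricSpace G) : WithPseudoMetric d → MetricQuotient d :=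
  SeparationQuotient.mk

/-- The composite `G → (G, d) → G_d`. -/
def quotMap {G : Type*} (d : PseudoMetricSpace G) : G → MetricQuotient d :=
  metricProj d ∘ toPseudo d

/-! ## Quotients of groupoids with Haar system -/

/-! The quotient identifies points on which a countable family `F` of continuous real functions
agrees. A weighted sum of differences of members of `F` is a continuous pseudo-metric with this zero
relation. `F` contains, for each compact set, a compactly supported function equal to `1` there;
these cutoffs descend to the quotient, which makes the quotient map proper.

For the structure to descend, agreement on `F` must be a congruence (`exists_isInvariantFamily`). By
Stone-Weierstrass on compact pieces, a continuous function on the σ-compact space of composable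
pairs depends on only countably many functions of the two factors (`mem_countablyDetermined`). So
the product makes countably many demands for each member of `F`, the cocycle countably many in all,
inversion and integration one for each member, and a countable `F` can meet them. Units that agree
on `F` then give equal integrals to the compactly supported members of `F`; since `F` is
multiplicative, a second use of Stone-Weierstrass upgrades this to equality of the pushed-forward
Haar measures (`map_eq_of_integral_eq`).

A congruence alone does not suffice: arrows whose classes are composable might have no composable
representatives. The Haar system excludes this. Equal pushforwards have equal supports, and the
support of the pushforward of `μ^x` is the image of the fibre `G^x`, so an arrow of the quotient
lifts along any lift of its target (`IsHaarQuotient.exists_lift`). Hence composable pairs map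
properly onto composable pairs, so operations and cocycle descend continuously; units likewise carry
the Haar system down. The pullback is a star morphism by change of variables.

The covers enter through bump functions: each cover has a pseudo-distance, determined by countably
many functions, whose unit balls refine it. Those for the `n`-th covers go into the summand of
weight `2^{-n}`. -/

theorem ArrowGroupoid.tgt_obj {G : Type*} [ArrowGroupoid G] (x : Obj G) : tgt x.1 = x.1 := by
  have h := tgt_src x.1
  rwa [x.2] at h

theorem ArrowGroupoid.mul_congr {G : Type*} [ArrowGroupoid G] {g g' h h' : G} (hg : g = g')
    (hh : h = h') (e : src g = tgt h) (e' : src g' = tgt h') : mul g h e = mul g' h' e' := by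
  subst hg; subst hh; rfl

/-- A proper map is closed, so the image of the support is closed, and by regularity its complement
is null. Conversely, a neighbourhood of `q x` pulls back to a neighbourhood of `x`. -/
theorem IsProperMap.support_map {X Y : Type*} [TopologicalSpace X] [MeasurableSpace X]
    [BorelSpace X] [TopologicalSpace Y] [MeasurableSpace Y] [BorelSpace Y] {q : X → Y}
    (hq : IsProperMap q) (m : Measure X) [m.Regular] :
    (m.map q).support = q '' m.support := by
  have hqm : Measurable q := hq.continuous.measurable
  apply Subset.antisymm
  · have hc : IsClosed (q '' m.support) := hq.isClosedMap _ Measure.isClosed_support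
    refine Measure.support_subset_of_isClosed hc ?_
    rw [mem_ae_iff, Measure.map_apply hqm hc.measurableSet.compl]
    refine measure_mono_null ?_ (Measure.measure_compl_support_of_regular (μ := m))
    intro x hx hxs
    exact hx ⟨x, hxs, rfl⟩
  · rintro _ ⟨x, hx, rfl⟩
    rw [Measure.mem_support_iff_forall] at hx ⊢
    intro U hU
    refine (hx _ (hq.continuous.continuousAt hU)).trans_le ?_
    exact Measure.le_map_apply hqm.aemeasurable U

theorem IsProperMap.isLocallyFiniteMeasure_map {X Y : Type*} [TopologicalSpace X]
    [MeasurableSpace X] [BorelSpace X] [TopologicalSpace Y] [T2Space Y] [LocallyCompactSpace Y]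
    [MeasurableSpace Y] [BorelSpace Y] {q : X → Y} (hq : IsProperMap q) (m : Measure X)
    [IsFiniteMeasureOnCompacts m] : IsLocallyFiniteMeasure (m.map q) := by
  refine ⟨fun y => ?_⟩
  obtain ⟨K, hK, hy⟩ := exists_compact_mem_nhds y
  refine ⟨K, hy, ?_⟩
  rw [Measure.map_apply hq.continuous.measurable hK.isClosed.measurableSet]
  exact (hq.isCompact_preimage hK).measure_lt_top

section Quotient

variable {G H : Type*} [TopologicalSpace G] [MeasurableSpace G] [BorelSpace G] [ArrowGroupoid G]
  [TopologicalSpace H] [MeasurableSpace H]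

/-- A proper surjection out of a groupoid with Haar system whose fibres form a congruence for
inversion and multiplication, and along which the Haar system is constant on fibres. -/
structure IsHaarQuotient (μ : HaarSystem G) (q : G → H) : Prop where
  proper : IsProperMap q
  surjective : Function.Surjective q
  inv_congr : ∀ g g', q g = q g' → q (inv g) = q (inv g')
  mul_congr : ∀ g h g' h' (e : src g = tgt h) (e' : src g' = tgt h'), q g = q g' → q h = q h' →
    q (mul g h e) = q (mul g' h' e')
  map_congr : ∀ x x' : Obj G, q x.1 = q x'.1 → (μ.meas x).map q = (μ.meas x').map q

namespace IsHaarQuotient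

variable {μ : HaarSystem G} {q : G → H} (hq : IsHaarQuotient μ q)
include hq

theorem src_congr {g g' : G} (h : q g = q g') : q (src g) = q (src g') := by
  rw [← inv_mul_self g, ← inv_mul_self g']
  exact hq.mul_congr _ _ _ _ _ _ (hq.inv_congr _ _ h) h

theorem tgt_congr {g g' : G} (h : q g = q g') : q (tgt g) = q (tgt g') := by
  rw [← mul_inv_self g, ← mul_inv_self g']
  exact hq.mul_congr _ _ _ _ _ _ h (hq.inv_congr _ _ h)

/-- Arrows of the quotient lift along any lift of their target. -/
theorem exists_lift [BorelSpace H] (g h : G) (e : q (src g) = q (tgt h)) :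
    ∃ h', q h' = q h ∧ src g = tgt h' := by
  have := μ.regular (srcObj g)
  have := μ.regular (tgtObj h)
  -- The units `src g` and `tgt h` have the same pushforward, hence their target fibres have the
  -- same image; `q h` lies in the second image, so in the first.
  have hm := congrArg Measure.support (hq.map_congr (srcObj g) (tgtObj h) e)
  rw [hq.proper.support_map, hq.proper.support_map, μ.support_eq, μ.support_eq] at hm
  have hh : q h ∈ q '' {k | tgt k = (tgtObj h).1} := ⟨h, rfl, rfl⟩
  rw [← hm] at hh
  obtain ⟨h', h1, h2⟩ := hh
  exact ⟨h', h2, h1.symm⟩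

/-- A chosen preimage. -/
noncomputable def lift (z : H) : G := (hq.surjective z).choose

theorem apply_lift (z : H) : q (hq.lift z) = z := (hq.surjective z).choose_spec

theorem exists_lift_comp [BorelSpace H] (z w : H)
    (e : q (src (hq.lift z)) = q (tgt (hq.lift w))) :
    ∃ p : Comp G, q p.1.1 = z ∧ q p.1.2 = w := by
  obtain ⟨h, h1, h2⟩ := hq.exists_lift _ _ e
  exact ⟨⟨(hq.lift z, h), h2⟩, hq.apply_lift z, h1.trans (hq.apply_lift w)⟩

theorem src_lift (g : G) : q (src (hq.lift (q g))) = q (src g) :=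
  hq.src_congr (hq.apply_lift (q g))

theorem tgt_lift (g : G) : q (tgt (hq.lift (q g))) = q (tgt g) :=
  hq.tgt_congr (hq.apply_lift (q g))

theorem inv_lift (g : G) : q (inv (hq.lift (q g))) = q (inv g) :=
  hq.inv_congr _ _ (hq.apply_lift (q g))

/-- The product on the quotient. -/
noncomputable def qmul [BorelSpace H] (z w : H)
    (e : q (src (hq.lift z)) = q (tgt (hq.lift w))) : H :=
  q (mul _ _ (hq.exists_lift_comp z w e).choose.2)

theorem qmul_apply [BorelSpace H] (g h : G) (e : src g = tgt h)
    (e' : q (src (hq.lift (q g))) = q (tgt (hq.lift (q h)))) :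
    hq.qmul (q g) (q h) e' = q (mul g h e) :=
  hq.mul_congr _ _ _ _ _ _ (hq.exists_lift_comp _ _ e').choose_spec.1
    (hq.exists_lift_comp _ _ e').choose_spec.2

/-- With equations `hg`, `hh` in place of fixed representatives, the product can be evaluated on any
convenient composable lifts without rewriting inside the dependent argument `e'`. -/
theorem qmul_eq [BorelSpace H] {z w : H} (g h : G) (hg : q g = z) (hh : q h = w)
    (e : src g = tgt h) (e' : q (src (hq.lift z)) = q (tgt (hq.lift w))) :
    hq.qmul z w e' = q (mul g h e) := by
  subst hg; subst hh
  exact hq.qmul_apply g h e e'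

/-- The groupoid structure on the quotient. -/
@[reducible] noncomputable def groupoid [BorelSpace H] : ArrowGroupoid H where
  src z := q (src (hq.lift z))
  tgt z := q (tgt (hq.lift z))
  inv z := q (inv (hq.lift z))
  mul z w e := hq.qmul z w e
  src_src z := by rw [hq.src_lift, src_src]
  tgt_src z := by rw [hq.tgt_lift, tgt_src]
  src_tgt z := by rw [hq.src_lift, src_tgt]
  tgt_tgt z := by rw [hq.tgt_lift, tgt_tgt]
  src_mul z w e := by
    unfold qmul
    rw [hq.src_lift, src_mul]
    refine hq.src_congr ?_
    rw [(hq.exists_lift_comp z w e).choose_spec.2, hq.apply_lift]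
  tgt_mul z w e := by
    unfold qmul
    rw [hq.tgt_lift, tgt_mul]
    refine hq.tgt_congr ?_
    rw [(hq.exists_lift_comp z w e).choose_spec.1, hq.apply_lift]
  assoc z w v e e' := by
    obtain ⟨g, rfl⟩ := hq.surjective z
    obtain ⟨h₀, rfl⟩ := hq.surjective w
    obtain ⟨k₀, rfl⟩ := hq.surjective v
    -- Lifting one factor after the other, each along the source of the previous one, gives a
    -- composable triple in `G`, where associativity is known.
    obtain ⟨h, hh, eh⟩ := hq.exists_lift g h₀ (by rw [← hq.src_lift, e, hq.tgt_lift])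
    obtain ⟨k, hk, ek⟩ := hq.exists_lift h k₀ (by
      rw [hq.src_congr hh, ← hq.src_lift, e', hq.tgt_lift])
    have h1 := hq.qmul_eq g h rfl hh eh e
    have h2 := hq.qmul_eq h k hh hk ek e'
    rw [hq.qmul_eq (mul g h eh) k h1.symm hk ((src_mul _ _ _).trans ek),
      hq.qmul_eq g (mul h k ek) rfl h2.symm (eh.trans (tgt_mul _ _ _).symm), assoc]
  mul_src z := by
    rw [hq.qmul_eq (hq.lift z) (src (hq.lift z)) (hq.apply_lift z) rfl (tgt_src _).symm,
      mul_src, hq.apply_lift]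
  tgt_mul_self z := by
    rw [hq.qmul_eq (tgt (hq.lift z)) (hq.lift z) rfl (hq.apply_lift z) (src_tgt _),
      ArrowGroupoid.tgt_mul_self, hq.apply_lift]
  src_inv z := by rw [hq.src_lift, src_inv]
  tgt_inv z := by rw [hq.tgt_lift, tgt_inv]
  mul_inv_self z := by
    rw [hq.qmul_eq (hq.lift z) (inv (hq.lift z)) (hq.apply_lift z) rfl (tgt_inv _).symm,
      ArrowGroupoid.mul_inv_self]
  inv_mul_self z := by
    rw [hq.qmul_eq (inv (hq.lift z)) (hq.lift z) rfl (hq.apply_lift z) (src_inv _),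
      ArrowGroupoid.inv_mul_self]

theorem isHom [BorelSpace H] : @IsHom _ _ _ hq.groupoid q :=
  letI := hq.groupoid
  { map_src := fun g => (hq.src_lift g).symm
    map_tgt := fun g => (hq.tgt_lift g).symm
    map_mul := fun g h e => (hq.qmul_apply g h e _).symm }

theorem map_inv [BorelSpace H] (g : G) : letI := hq.groupoid; q (inv g) = inv (q g) :=
  (hq.inv_lift g).symm

end IsHaarQuotient

end Quotient

theorem integral_map_eq_integral_pullback {X Y : Type*} [TopologicalSpace X] [MeasurableSpace X]
    [BorelSpace X] [TopologicalSpace Y] [MeasurableSpace Y] [BorelSpace Y] {q : X → Y}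
    (hq : IsProperCont q) (m : Measure X) (f : C_c(Y, ℂ)) :
    ∫ y, f y ∂(m.map q) = ∫ x, pullback hq f x ∂m :=
  integral_map hq.1.measurable.aemeasurable (map_continuous f).measurable.aestronglyMeasurable

/-! ### Proper surjective functors -/

section Functor

variable {G H : Type*} [TopologicalSpace G] [ArrowGroupoid G] [IsTopGroupoid G]
  [TopologicalSpace H] [T2Space H] [ArrowGroupoid H] {q : G → H}

theorem ArrowGroupoid.IsHom.obj_surjective {G H : Type*} [ArrowGroupoid G] [ArrowGroupoid H]
    {q : G → H} (hom : IsHom q) (hs : Function.Surjective q) :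
    Function.Surjective hom.obj := by
  rintro ⟨z, hz⟩
  obtain ⟨g, rfl⟩ := hs z
  exact ⟨srcObj g, Subtype.ext ((hom.map_src g).trans hz)⟩

theorem ArrowGroupoid.IsHom.isProperMap_obj (hom : IsHom q) (hp : IsProperMap q) :
    IsProperMap hom.obj := by
  have hc : IsClosed {x : G | src x = x} := isClosed_eq continuous_src continuous_id
  have h : IsProperMap ((Subtype.val : Obj H → H) ∘ hom.obj) :=
    hp.comp hc.isProperMap_subtypeVal
  refine isProperMap_of_comp_of_t2 ?_ continuous_subtype_val h
  exact Continuous.subtype_mk (hp.continuous.comp continuous_subtype_val) _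

/-- The composable pairs form a closed subset of `G × G`, and `q × q` is proper. Once this map is
surjective it is a quotient map, so continuity on composable pairs of `H` can be tested in `G`. -/
theorem ArrowGroupoid.IsHom.isProperMap_comp (hom : IsHom q) (hp : IsProperMap q) :
    IsProperMap hom.comp := by
  have h : IsProperMap ((Subtype.val : Comp H → H × H) ∘ hom.comp) :=
    (hp.prodMap hp).comp (isClosed_comp (G := G)).isProperMap_subtypeVal
  refine isProperMap_of_comp_of_t2 ?_ continuous_subtype_val h
  exact Continuous.subtype_mk ((hp.prodMap hp).continuous.comp continuous_subtype_val) _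

theorem IsProperMap.isQuotientMap {X Y : Type*} [TopologicalSpace X] [TopologicalSpace Y]
    {f : X → Y} (hf : IsProperMap f) (hs : Function.Surjective f) : IsQuotientMap f :=
  hf.isClosedMap.isQuotientMap hf.continuous hs

end Functor

/-! ### Measurability of integrands extended by zero -/

section Measurability

variable {H : Type*} [TopologicalSpace H] [ArrowGroupoid H] [IsTopGroupoid H]
  [MeasurableSpace H] [BorelSpace H]

/-- Left translates and convolution integrands can jump at the boundary of a target fibre, so they
are only Borel; this is what the change of variables under `q` requires. -/
theorem measurable_of_continuousOn_of_eq_zero {X : Type*} [TopologicalSpace X]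
    [MeasurableSpace X] [OpensMeasurableSpace X] {s : Set X} (hs : IsClosed s) {f : X → ℂ}
    (hf : ContinuousOn f s) (h0 : ∀ x ∉ s, f x = 0) : Measurable f := by
  refine measurable_of_restrict_of_restrict_compl hs.measurableSet ?_ ?_
  · exact (continuousOn_iff_continuous_domRestrict.mp hf).measurable
  · have : sᶜ.domRestrict f = fun _ => 0 := by
      funext x
      exact h0 x.1 x.2
    rw [this]
    exact measurable_const

theorem measurable_leftTranslate (z : H) (f : C_c(H, ℂ)) : Measurable (leftTranslate z f) := by
  have hc : IsClosed {w : H | src z = tgt w} := isClosed_eq continuous_const continuous_tgt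
  refine measurable_of_continuousOn_of_eq_zero hc ?_ ?_
  · rw [continuousOn_iff_continuous_domRestrict]
    have : {w : H | src z = tgt w}.domRestrict (leftTranslate z f) =
        fun w => f (mul z w.1 w.2) := by
      funext w
      have hw : src z = tgt w.1 := w.2
      simp [Set.domRestrict, leftTranslate, hw]
    rw [this]
    have hw : Continuous fun w : {w : H | src z = tgt w} => (⟨(z, w.1), w.2⟩ : Comp H) :=
      Continuous.subtype_mk (continuous_const.prodMk continuous_subtype_val) _
    exact f.continuous.comp (IsTopGroupoid.continuous_mul.comp hw)
  · intro w hw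
    have hw : ¬ src z = tgt w := hw
    simp [leftTranslate, hw]

theorem measurable_convIntegrand (τ : TwoCocycle H) (f g : C_c(H, ℂ)) (z : H) :
    Measurable (convIntegrand τ f g z) := by
  have hc : IsClosed {w : H | src z = tgt w} := isClosed_eq continuous_const continuous_tgt
  refine measurable_of_continuousOn_of_eq_zero hc ?_ ?_
  · exact (continuousOn_convIntegrand τ f g).comp (f := fun y => (z, y)) (by fun_prop)
      fun y hy => hy
  · intro w hw
    have hw : ¬ src z = tgt w := hw
    simp [convIntegrand, hw]

end Measurability

/-! ### Measures and cocycle values on the quotient through chosen lifts -/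

namespace IsHaarQuotient

variable {G H : Type*} [TopologicalSpace G] [MeasurableSpace G] [BorelSpace G] [ArrowGroupoid G]
  [TopologicalSpace H] [MeasurableSpace H] {μ : HaarSystem G} {q : G → H}
  (hq : IsHaarQuotient μ q)
include hq

theorem isProperCont : IsProperCont q :=
  ⟨hq.proper.continuous, fun _ _ hK => hq.proper.isCompact_preimage hK⟩

variable [BorelSpace H]

theorem comp_surjective : letI := hq.groupoid; Function.Surjective hq.isHom.comp := by
  let _ := hq.groupoid
  rintro ⟨⟨z, w⟩, e⟩
  obtain ⟨p, h1, h2⟩ := hq.exists_lift_comp z w e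
  exact ⟨p, Subtype.ext (Prod.ext h1 h2)⟩

/-- The pushed forward family of measures. -/
noncomputable def meas (y : letI := hq.groupoid; Obj H) : Measure H :=
  letI := hq.groupoid
  (μ.meas (hq.isHom.obj_surjective hq.surjective y).choose).map q

theorem meas_obj (x : Obj G) : letI := hq.groupoid;
    hq.meas (hq.isHom.obj x) = (μ.meas x).map q := by
  let _ := hq.groupoid
  refine hq.map_congr _ _ ?_
  exact congrArg Subtype.val (hq.isHom.obj_surjective hq.surjective (hq.isHom.obj x)).choose_spec

theorem toFun_choose {σ : TwoCocycle G}
    (hσ : ∀ p p' : Comp G, q p.1.1 = q p'.1.1 → q p.1.2 = q p'.1.2 → σ.toFun p = σ.toFun p')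
    {z w : H} {g h : G} (e : src g = tgt h) (hg : q g = z) (hh : q h = w)
    (e' : q (src (hq.lift z)) = q (tgt (hq.lift w))) : letI := hq.groupoid;
    σ.toFun (hq.comp_surjective ⟨(z, w), e'⟩).choose = σ.toFun ⟨(g, h), e⟩ := by
  let _ := hq.groupoid
  have hc := congrArg Subtype.val (hq.comp_surjective ⟨(z, w), e'⟩).choose_spec
  exact hσ _ _ ((congrArg Prod.fst hc).trans hg.symm) ((congrArg Prod.snd hc).trans hh.symm)

end IsHaarQuotient

/-! ### Topology, Haar system and cocycle of the quotient -/

namespace IsHaarQuotient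

variable {G H : Type*} [TopologicalSpace G] [MeasurableSpace G] [BorelSpace G] [ArrowGroupoid G]
  [IsTopGroupoid G] [TopologicalSpace H] [T2Space H] [MeasurableSpace H] [BorelSpace H]
  {μ : HaarSystem G} {q : G → H} (hq : IsHaarQuotient μ q)
include hq

theorem isTopGroupoid [LocallyCompactSpace H] :
    letI := hq.groupoid; IsTopGroupoid H := by
  let _ := hq.groupoid
  refine ⟨inferInstance, inferInstance, ?_, ?_⟩
  · rw [(hq.proper.isQuotientMap hq.surjective).continuous_iff]
    have : (inv : H → H) ∘ q = q ∘ inv := funext fun g => (hq.map_inv g).symm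
    rw [this]
    exact hq.proper.continuous.comp IsTopGroupoid.continuous_inv
  · rw [((hq.isHom.isProperMap_comp hq.proper).isQuotientMap hq.comp_surjective).continuous_iff]
    have : (fun p : Comp H => mul p.1.1 p.1.2 p.2) ∘ hq.isHom.comp =
        q ∘ fun p : Comp G => mul p.1.1 p.1.2 p.2 :=
      funext fun p => (hq.isHom.map_mul _ _ p.2).symm
    rw [this]
    exact hq.proper.continuous.comp IsTopGroupoid.continuous_mul

/-- The Haar system on the quotient. -/
noncomputable def haarSystem [LocallyCompactSpace H] [TopologicalSpace.PseudoMetrizableSpace H]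
    [SigmaCompactSpace H] : letI := hq.groupoid; HaarSystem H :=
  letI := hq.groupoid
  haveI := hq.isTopGroupoid
  { meas := hq.meas
    regular := fun y => by
      obtain ⟨x, rfl⟩ := hq.isHom.obj_surjective hq.surjective y
      rw [hq.meas_obj]
      have := μ.regular x
      have := hq.proper.isLocallyFiniteMeasure_map (μ.meas x)
      -- A locally finite Borel measure on a σ-compact pseudo-metrizable space is regular.
      infer_instance
    support_eq := fun y => by
      obtain ⟨x, rfl⟩ := hq.isHom.obj_surjective hq.surjective y
      have := μ.regular x
      rw [hq.meas_obj, hq.proper.support_map, μ.support_eq]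
      ext z
      constructor
      · rintro ⟨g, hg, rfl⟩
        exact (hq.isHom.map_tgt g).symm.trans (congrArg q hg)
      · intro hz
        obtain ⟨g, rfl⟩ := hq.surjective z
        have hz : tgt (q g) = q x.1 := hz
        rw [← hq.isHom.map_tgt] at hz
        -- The target of `g` is only equivalent to `x`; a lift of the same class with target exactly
        -- `x` is needed.
        obtain ⟨g', h1, h2⟩ := hq.exists_lift x.1 g (by rw [x.2, hz])
        exact ⟨g', h2.symm.trans x.2, h1⟩
    continuous_integral := fun f => by
      rw [((hq.isHom.isProperMap_obj hq.proper).isQuotientMap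
        (hq.isHom.obj_surjective hq.surjective)).continuous_iff]
      refine (μ.continuous_integral (pullback hq.isProperCont f)).congr fun x => ?_
      simp only [Function.comp_apply]
      rw [hq.meas_obj, integral_map_eq_integral_pullback]
    left_invariant := fun z f => by
      obtain ⟨g, rfl⟩ := hq.surjective z
      have ht : tgtObj (q g) = hq.isHom.obj (tgtObj g) :=
        Subtype.ext (hq.isHom.map_tgt g).symm
      have hs : srcObj (q g) = hq.isHom.obj (srcObj g) :=
        Subtype.ext (hq.isHom.map_src g).symm
      rw [ht, hs, hq.meas_obj, hq.meas_obj,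
        integral_map_eq_integral_pullback hq.isProperCont,
        integral_map hq.proper.continuous.measurable.aemeasurable
          (measurable_leftTranslate (q g) f).aestronglyMeasurable]
      refine (μ.left_invariant g (pullback hq.isProperCont f)).trans ?_
      refine integral_congr_ae ?_
      -- The two integrands may differ at an `h` that is not composable with `g` although `q h` is
      -- composable with `q g`; such `h` form a null set.
      filter_upwards [μ.ae_tgt (srcObj g)] with h hh
      have e : src g = tgt h := hh.symm
      have e' : src (q g) = tgt (q h) := by
        rw [← hq.isHom.map_src, ← hq.isHom.map_tgt, e]
      simp only [leftTranslate, e, e', dif_pos]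
      exact congrArg f (hq.isHom.map_mul g h e) }

theorem haarPreserving [LocallyCompactSpace H] [TopologicalSpace.PseudoMetrizableSpace H]
    [SigmaCompactSpace H] : letI := hq.groupoid; HaarPreserving hq.isHom μ hq.haarSystem :=
  fun x => (hq.meas_obj x).symm

/-- The cocycle on the quotient, evaluated on chosen lifts. -/
noncomputable def cocycle {σ : TwoCocycle G}
    (hσ : ∀ p p' : Comp G, q p.1.1 = q p'.1.1 → q p.1.2 = q p'.1.2 → σ.toFun p = σ.toFun p') : letI := hq.groupoid; TwoCocycle H :=
  letI := hq.groupoid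
  { toFun := fun p => σ.toFun (hq.comp_surjective p).choose
    continuous_toFun := by
      rw [((hq.isHom.isProperMap_comp hq.proper).isQuotientMap hq.comp_surjective).continuous_iff]
      exact σ.continuous_toFun.congr fun p => (hq.toFun_choose hσ p.2 rfl rfl _).symm
    cocycle := fun z w v e e' => by
      obtain ⟨⟨⟨g, h⟩, eh⟩, hp⟩ := hq.comp_surjective ⟨(z, w), e⟩
      have hg : q g = z := congrArg (fun p => p.1.1) hp
      have hh : q h = w := congrArg (fun p => p.1.2) hp
      subst hg hh
      obtain ⟨k₀, rfl⟩ := hq.surjective v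
      obtain ⟨k, hk, ek⟩ := hq.exists_lift h k₀
        ((hq.isHom.map_src h).trans (e'.trans (hq.isHom.map_tgt k₀).symm))
      rw [hq.toFun_choose hσ eh rfl rfl, hq.toFun_choose hσ ek rfl hk,
        hq.toFun_choose hσ ((src_mul g h eh).trans ek) (hq.isHom.map_mul g h eh) hk,
        hq.toFun_choose hσ (eh.trans (tgt_mul h k ek).symm) rfl
          ((hq.isHom.map_mul h k ek).trans (ArrowGroupoid.mul_congr rfl hk _ _))]
      exact σ.cocycle g h k eh ek }

theorem cocyclePreserving {σ : TwoCocycle G}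
    (hσ : ∀ p p' : Comp G, q p.1.1 = q p'.1.1 → q p.1.2 = q p'.1.2 → σ.toFun p = σ.toFun p') : letI := hq.groupoid;
    CocyclePreserving hq.isHom σ (hq.cocycle hσ) :=
  fun p => (hq.toFun_choose hσ p.2 rfl rfl _).symm

end IsHaarQuotient

/-! ### The pullback is a star morphism -/

theorem ArrowGroupoid.inv_eq_of_mul_eq {G : Type*} [ArrowGroupoid G] {g h : G} (e : src g = tgt h)
    (hm : mul g h e = tgt g) : h = inv g := by
  have h1 := assoc (inv g) g h (src_inv g) e
  rw [ArrowGroupoid.mul_congr rfl hm _ (by rw [src_inv, tgt_tgt]),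
    ArrowGroupoid.mul_congr (inv_mul_self g) rfl _ (by rw [src_src, e])] at h1
  rw [ArrowGroupoid.mul_congr (e.trans rfl) rfl _ (src_tgt h), tgt_mul_self] at h1
  rw [h1, ArrowGroupoid.mul_congr rfl (src_inv g).symm _ (tgt_src _).symm, mul_src]

theorem ArrowGroupoid.IsHom.map_inv {G H : Type*} [ArrowGroupoid G] [ArrowGroupoid H] {q : G → H}
    (hom : IsHom q) (g : G) : q (inv g) = inv (q g) := by
  refine inv_eq_of_mul_eq (by rw [← hom.map_src, ← hom.map_tgt, tgt_inv]) ?_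
  rw [← hom.map_mul g (inv g) (tgt_inv g).symm, mul_inv_self, hom.map_tgt]

/-- By the universal property: pulling an admissible topology on `C_c(X)` back along the linear map
gives an admissible one on `C_c(Y)`, since `C_K(Y)` goes to functions supported in the compact set
`q ⁻¹' K`, continuously in the sup norm. -/
theorem continuous_indLim_pullback {X Y : Type*} [TopologicalSpace X] [TopologicalSpace Y]
    {q : X → Y} (hq : IsProperCont q) (hK : ∀ K, IsCompact K → IsCompact (q ⁻¹' K)) :
    Continuous[indLimTopology Y, indLimTopology X] (pullback hq) := by
  rw [continuous_sInf_rng]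
  rintro τ ⟨h1, h2, h3, h4⟩
  rw [continuous_iff_le_induced]
  refine sInf_le ⟨?_, ?_, ?_, ?_⟩
  · exact topologicalAddGroup_induced (pullback hq)
  · exact continuousSMul_induced (pullback hq)
  · exact LocallyConvexSpace.induced ((pullback hq).restrictScalars ℝ)
  · intro K hKc
    rw [continuous_induced_rng]
    have hs : ∀ f : {f : C_c(Y, ℂ) // tsupport f ⊆ K}, tsupport (pullback hq f.1) ⊆ q ⁻¹' K :=
      fun f => (tsupport_comp_subset_preimage f.1 hq.1).trans (preimage_mono f.2)
    have h := h4 _ (hK K hKc)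
    refine @Continuous.comp _ _ _ (_) (_) τ
      (fun f : {f : C_c(Y, ℂ) // tsupport f ⊆ K} =>
        (⟨pullback hq f.1, hs f⟩ : {f : C_c(X, ℂ) // tsupport f ⊆ q ⁻¹' K})) _ h ?_
    rw [continuous_induced_rng]
    exact @Continuous.comp _ _ _ (_) _ _
      (fun f : {f : C_c(Y, ℂ) // tsupport f ⊆ K} => f.1.toBoundedContinuousFunction)
      (fun f => f.compContinuous ⟨q, hq.1⟩)
      (BoundedContinuousFunction.continuous_compContinuous (⟨q, hq.1⟩ : C(X, Y)))
      continuous_induced_dom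

theorem pullback_adj {G H : Type*} [TopologicalSpace G] [ArrowGroupoid G] [TopologicalSpace H]
    [ArrowGroupoid H] [IsTopGroupoid G] [IsTopGroupoid H] {q : G → H} (hom : IsHom q)
    (hp : IsProperCont q) {σ : TwoCocycle G} {τ : TwoCocycle H} (hσ : CocyclePreserving hom σ τ)
    (f : C_c(H, ℂ)) : pullback hp (adj τ f) = adj σ (pullback hp f) := by
  ext x
  have hi := hom.map_inv x
  change adjFun τ f (q x) = adjFun σ (pullback hp f) x
  unfold adjFun
  rw [hσ]
  have h2 : f (inv (q x)) = pullback hp f (inv x) := congrArg f hi.symm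
  rw [h2]
  congr 4
  exact Subtype.ext (Prod.ext rfl hi.symm)

section StarMorphism

variable {G H : Type*} [TopologicalSpace G] [MeasurableSpace G] [BorelSpace G] [ArrowGroupoid G]
  [TopologicalSpace H] [MeasurableSpace H] [BorelSpace H] [ArrowGroupoid H]
  [IsTopGroupoid H] {q : G → H} (hom : IsHom q) (hp : IsProperCont q)
  {μ : HaarSystem G} {ν : HaarSystem H}

/-- Each fibre integral of the pullback is a fibre integral of `f` at the image unit, so both
suprema on `G` run over values that already occur on `H`. -/
theorem iNorm_pullback_le (hμ : HaarPreserving hom μ ν) (f : C_c(H, ℂ)) : iNorm μ (pullback hp f) ≤ iNorm ν f := by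
  have hm : Measurable fun z => ‖f z‖ₑ := (map_continuous f).enorm.measurable
  have hm' : Measurable fun z => ‖f (inv z)‖ₑ :=
    ((map_continuous f).comp IsTopGroupoid.continuous_inv).enorm.measurable
  refine max_le_max (iSup_le fun x => ?_) (iSup_le fun x => ?_)
  · refine le_iSup_of_le (hom.obj x) ?_
    rw [← hμ, lintegral_map hm hp.1.measurable]
    rfl
  · refine le_iSup_of_le (hom.obj x) ?_
    rw [← hμ, lintegral_map hm' hp.1.measurable]
    simp only [← hom.map_inv]
    rfl

variable [IsTopGroupoid G] {σ : TwoCocycle G} {τ : TwoCocycle H}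

theorem pullback_conv (hμ : HaarPreserving hom μ ν)
    (hσ : CocyclePreserving hom σ τ) (f g : C_c(H, ℂ)) :
    pullback hp (conv ν τ f g) = conv μ σ (pullback hp f) (pullback hp g) := by
  ext x
  change ∫ w, convIntegrand τ f g (q x) w ∂(ν.meas (srcObj (q x))) =
    ∫ y, convIntegrand σ (pullback hp f) (pullback hp g) x y ∂(μ.meas (srcObj x))
  have hs : srcObj (q x) = hom.obj (srcObj x) := Subtype.ext (hom.map_src x).symm
  rw [hs, ← hμ, integral_map hp.1.measurable.aemeasurable
    (measurable_convIntegrand τ f g (q x)).aestronglyMeasurable]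
  refine integral_congr_ae ?_
  filter_upwards [μ.ae_tgt (srcObj x)] with y hy
  have e : src x = tgt y := hy.symm
  have e' : src (q x) = tgt (q y) := by rw [← hom.map_src, ← hom.map_tgt, e]
  simp only [convIntegrand, e, e', dif_pos]
  rw [hσ]
  have hm := hom.map_mul x y e
  have hi := hom.map_inv y
  have h1 : f (mul (q x) (q y) e') = pullback hp f (mul x y e) := congrArg f hm.symm
  have h2 : g (inv (q y)) = pullback hp g (inv y) := congrArg g hi.symm
  have h3 : (⟨(mul (q x) (q y) e', inv (q y)), (src_mul _ _ _).trans (tgt_inv _).symm⟩ : Comp H) =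
      hom.comp ⟨(mul x y e, inv y), (src_mul x y e).trans (tgt_inv y).symm⟩ :=
    Subtype.ext (Prod.ext hm.symm hi.symm)
  rw [h1, h2, h3]

theorem isStarMorphism_pullback (hμ : HaarPreserving hom μ ν)
    (hσ : CocyclePreserving hom σ τ) : IsStarMorphism ν τ μ σ (pullback hp) where
  map_conv := pullback_conv hom hp hμ hσ
  map_adj := pullback_adj hom hp hσ
  continuous_iNorm f ε hε := by
    refine ⟨ε, hε, fun g hg => ?_⟩
    rw [← map_sub]
    exact (iNorm_pullback_le hom hp hμ _).trans_lt hg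
  continuous_indLim := continuous_indLim_pullback hp fun K hK => hp.2 K hK.isClosed hK

end StarMorphism

/-! ## Countable families of functions -/

/-- Two points agree for a family of functions if no member of the family separates them. -/
def AgreeOn {X : Type*} [TopologicalSpace X] (F : Set C(X, ℝ)) (x y : X) : Prop :=
  ∀ f ∈ F, f x = f y

theorem AgreeOn.mono {X : Type*} [TopologicalSpace X] {F F' : Set C(X, ℝ)} (h : F ⊆ F') {x y : X}
    (hxy : AgreeOn F' x y) : AgreeOn F x y := fun f hf => hxy f (h hf)

/-- The functions on `Y` that depend only on the values of countably many functions on `X` at the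
two points `p₁ y` and `p₂ y`. -/
def countablyDetermined {X Y : Type*} [TopologicalSpace X] [TopologicalSpace Y] (p₁ p₂ : C(Y, X)) :
    Subalgebra ℝ C(Y, ℝ) where
  carrier := {u | ∃ A : Set C(X, ℝ), A.Countable ∧ ∀ y y', AgreeOn A (p₁ y) (p₁ y') →
    AgreeOn A (p₂ y) (p₂ y') → u y = u y'}
  mul_mem' := by
    rintro u v ⟨A, hA, hu⟩ ⟨B, hB, hv⟩
    refine ⟨A ∪ B, hA.union hB, fun y y' h1 h2 => ?_⟩
    rw [ContinuousMap.mul_apply, ContinuousMap.mul_apply,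
      hu y y' (h1.mono subset_union_left) (h2.mono subset_union_left),
      hv y y' (h1.mono subset_union_right) (h2.mono subset_union_right)]
  add_mem' := by
    rintro u v ⟨A, hA, hu⟩ ⟨B, hB, hv⟩
    refine ⟨A ∪ B, hA.union hB, fun y y' h1 h2 => ?_⟩
    rw [ContinuousMap.add_apply, ContinuousMap.add_apply,
      hu y y' (h1.mono subset_union_left) (h2.mono subset_union_left),
      hv y y' (h1.mono subset_union_right) (h2.mono subset_union_right)]
  algebraMap_mem' r := ⟨∅, countable_empty, fun _ _ _ _ => rfl⟩

theorem exists_continuous_ne {X : Type*} [TopologicalSpace X] [T2Space X] [LocallyCompactSpace X]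
    {x y : X} (h : x ≠ y) : ∃ a : C(X, ℝ), a x ≠ a y := by
  obtain ⟨a, h1, h0, -, -⟩ := exists_continuous_one_zero_of_isCompact (X := X)
    (isCompact_singleton (x := x)) (isClosed_singleton (x := y)) (by simpa using h)
  refine ⟨a, ?_⟩
  rw [h1 rfl, h0 rfl]
  simp

/-- The determined functions form a subalgebra, which separates points because functions on `X` do
so after composition with `p₁` or `p₂`. Stone-Weierstrass approximates `u` on each compact piece to
each precision `1/(k+1)`; the countably many data of all approximants determine `u`. -/
theorem mem_countablyDetermined {X Y : Type*} [TopologicalSpace X] [T2Space X]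
    [LocallyCompactSpace X] [TopologicalSpace Y] [SigmaCompactSpace Y] {p₁ p₂ : C(Y, X)}
    (hinj : ∀ y y', p₁ y = p₁ y' → p₂ y = p₂ y' → y = y') (u : C(Y, ℝ)) :
    u ∈ countablyDetermined p₁ p₂ := by
  have hsep : (countablyDetermined p₁ p₂).SeparatesPoints := by
    intro y y' hy
    by_cases h1 : p₁ y = p₁ y'
    · obtain ⟨a, ha⟩ := exists_continuous_ne fun h2 => hy (hinj y y' h1 h2)
      exact ⟨_, ⟨a.comp p₂, ⟨{a}, countable_singleton a, fun _ _ _ h => h a rfl⟩, rfl⟩, ha⟩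
    · obtain ⟨a, ha⟩ := exists_continuous_ne h1
      exact ⟨_, ⟨a.comp p₁, ⟨{a}, countable_singleton a, fun _ _ h _ => h a rfl⟩, rfl⟩, ha⟩
  have happ : ∀ n k : ℕ, ∃ g ∈ countablyDetermined p₁ p₂, ∀ y ∈ compactCovering Y n,
      ‖g y - u y‖ < 1 / ((k : ℝ) + 1) := fun n k =>
    ContinuousMap.exists_mem_subalgebra_near_continuous_of_isCompact_of_separatesPoints hsep u
      (isCompact_compactCovering Y n) (by positivity)
  choose g hg hgu using happ
  choose A hA hAg using hg
  refine ⟨⋃ n, ⋃ k, A n k, countable_iUnion fun n => countable_iUnion fun k => hA n k, ?_⟩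
  intro y y' h1 h2
  obtain ⟨n, hn⟩ := exists_mem_compactCovering y
  obtain ⟨m, hm⟩ := exists_mem_compactCovering y'
  -- Both points must lie in one compact piece, so that a single sequence of approximants converges
  -- at each.
  have hy := compactCovering_subset Y (le_max_left n m) hn
  have hy' := compactCovering_subset Y (le_max_right n m) hm
  have hlim : ∀ z ∈ compactCovering Y (max n m),
      Filter.Tendsto (fun k => g (max n m) k z) Filter.atTop (𝓝 (u z)) := by
    intro z hz
    rw [tendsto_iff_norm_sub_tendsto_zero]
    exact squeeze_zero (fun _ => norm_nonneg _) (fun k => (hgu _ k z hz).le)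
      tendsto_one_div_add_atTop_nhds_zero_nat
  refine tendsto_nhds_unique (hlim y hy) ((hlim y' hy').congr fun k => ?_)
  have hsub : A (max n m) k ⊆ ⋃ n, ⋃ k, A n k :=
    (subset_iUnion (A (max n m)) k).trans (subset_iUnion (fun n => ⋃ k, A n k) _)
  exact (hAg _ k y y' (h1.mono hsub) (h2.mono hsub)).symm

/-- Iterating the enlargement countably often suffices, since any two elements of the union already
occur at a common finite stage. -/
theorem exists_countable_closed {T : Type*} {A : Set T} (hA : A.Countable) (Ψ : T → T → Set T)
    (hΨ : ∀ s t, (Ψ s t).Countable) :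
    ∃ F : Set T, F.Countable ∧ A ⊆ F ∧ ∀ s ∈ F, ∀ t ∈ F, Ψ s t ⊆ F := by
  let Φ : Set T → Set T := fun B => B ∪ ⋃ s ∈ B, ⋃ t ∈ B, Ψ s t
  have hmono : Monotone fun n => Φ^[n] A := monotone_nat_of_le_succ fun n => by
    rw [Function.iterate_succ_apply']
    exact subset_union_left
  refine ⟨⋃ n, Φ^[n] A, countable_iUnion fun n => ?_, subset_iUnion (fun n => Φ^[n] A) 0, ?_⟩
  · induction n with
    | zero => exact hA
    | succ n ih =>
      rw [Function.iterate_succ_apply']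
      exact ih.union (ih.biUnion fun s _ => ih.biUnion fun t _ => hΨ s t)
  · intro s hs t ht r hr
    obtain ⟨n, hn⟩ := mem_iUnion.mp hs
    obtain ⟨m, hm⟩ := mem_iUnion.mp ht
    refine mem_iUnion.mpr ⟨max n m + 1, ?_⟩
    rw [Function.iterate_succ_apply']
    exact Or.inr (mem_biUnion (hmono (le_max_left n m) hn)
      (mem_biUnion (hmono (le_max_right n m) hm) hr))

/-! ### Countable families compatible with the groupoid, the cocycle and the Haar system -/

section Family

variable {G : Type*} [TopologicalSpace G] [MeasurableSpace G] [BorelSpace G] [ArrowGroupoid G]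

/-- Countable families of functions whose joint fibres are compatible with inversion, product,
cocycle and Haar system. -/
structure IsInvariantFamily (μ : HaarSystem G) (σ : TwoCocycle G) (F : Set C(G, ℝ)) : Prop where
  countable : F.Countable
  one_mem : 1 ∈ F
  mul_mem : ∀ a ∈ F, ∀ b ∈ F, a * b ∈ F
  exhausting : ∀ K : Set G, IsCompact K → ∃ χ ∈ F, HasCompactSupport χ ∧ ∀ x ∈ K, χ x = 1
  inv_agree : ∀ g g', AgreeOn F g g' → AgreeOn F (inv g) (inv g')
  mul_agree : ∀ p p' : Comp G, AgreeOn F p.1.1 p'.1.1 → AgreeOn F p.1.2 p'.1.2 →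
    AgreeOn F (mul p.1.1 p.1.2 p.2) (mul p'.1.1 p'.1.2 p'.2)
  cocycle_eq : ∀ p p' : Comp G, AgreeOn F p.1.1 p'.1.1 → AgreeOn F p.1.2 p'.1.2 →
    σ.toFun p = σ.toFun p'
  integral_eq : ∀ a ∈ F, HasCompactSupport a → ∀ x x' : Obj G, AgreeOn F x.1 x'.1 →
    ∫ g, a g ∂(μ.meas x) = ∫ g, a g ∂(μ.meas x')

theorem HaarSystem.continuous_integral_real (μ : HaarSystem G) {a : C(G, ℝ)}
    (ha : HasCompactSupport a) : Continuous fun x => ∫ g, a g ∂(μ.meas x) := by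
  let ac : C_c(G, ℂ) := ⟨⟨fun y => (a y : ℂ), by fun_prop⟩,
    ha.comp_left (g := Complex.ofReal) (by simp)⟩
  refine (Complex.continuous_re.comp (μ.continuous_integral ac)).congr fun x => ?_
  have : ∫ y, ac y ∂(μ.meas x) = ((∫ y, a y ∂(μ.meas x) : ℝ) : ℂ) := integral_ofReal
  simp [this]

variable [IsTopGroupoid G] [SigmaCompactSpace G]

theorem exists_isInvariantFamily (μ : HaarSystem G) (σ : TwoCocycle G) {A : Set C(G, ℝ)}
    (hA : A.Countable) : ∃ F, A ⊆ F ∧ IsInvariantFamily μ σ F := by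
  classical
  let inC : C(G, G) := ⟨inv, IsTopGroupoid.continuous_inv⟩
  let mulC : C(Comp G, G) := ⟨fun p => mul p.1.1 p.1.2 p.2, IsTopGroupoid.continuous_mul⟩
  let p₁ : C(Comp G, G) := ⟨fun p => p.1.1, by fun_prop⟩
  let p₂ : C(Comp G, G) := ⟨fun p => p.1.2, by fun_prop⟩
  have : SigmaCompactSpace (Comp G) :=
    (isClosed_comp (G := G)).isClosedEmbedding_subtypeVal.sigmaCompactSpace
  have hdet : ∀ u : C(Comp G, ℝ), u ∈ countablyDetermined p₁ p₂ :=
    mem_countablyDetermined fun y y' h1 h2 => Subtype.ext (Prod.ext h1 h2)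
  choose D hDc hD using hdet
  have hint : ∀ a : C(G, ℝ), ∃ b : C(G, ℝ), HasCompactSupport a →
      ∀ g, b g = ∫ h, a h ∂(μ.meas (tgtObj g)) := by
    intro a
    by_cases ha : HasCompactSupport a
    · exact ⟨⟨fun g => ∫ h, a h ∂(μ.meas (tgtObj g)), (μ.continuous_integral_real ha).comp
        (Continuous.subtype_mk continuous_tgt _)⟩, fun _ _ => rfl⟩
    · exact ⟨0, fun h => absurd h ha⟩
  choose I hI using hint
  have hχ : ∀ n, ∃ χ : C(G, ℝ), HasCompactSupport χ ∧
      ∀ x ∈ CompactExhaustion.choice G n, χ x = 1 := by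
    intro n
    obtain ⟨χ, h1, -, h2, -⟩ := exists_continuous_one_zero_of_isCompact (X := G)
      ((CompactExhaustion.choice G).isCompact n) isClosed_empty (disjoint_empty _)
    exact ⟨χ, h2, fun x hx => h1 hx⟩
  choose χ hχc hχ1 using hχ
  let reσ : C(Comp G, ℝ) := ⟨fun p => (σ.toFun p : ℂ).re,
    Complex.continuous_re.comp (continuous_subtype_val.comp σ.continuous_toFun)⟩
  let imσ : C(Comp G, ℝ) := ⟨fun p => (σ.toFun p : ℂ).im,
    Complex.continuous_im.comp (continuous_subtype_val.comp σ.continuous_toFun)⟩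
  -- The seed holds what is needed once: `A`, the cutoffs, `1` and the data of the cocycle. The
  -- operation adds what is needed for each member; its unary parts are reached with both arguments
  -- equal.
  obtain ⟨F, hFc, hAF, hF⟩ := exists_countable_closed
    (A := A ∪ range χ ∪ {1} ∪ D reσ ∪ D imσ)
    ((((hA.union (countable_range χ)).union (countable_singleton 1)).union (hDc _)).union (hDc _))
    (fun a b => {a * b, a.comp inC, I a} ∪ D (a.comp mulC))
    (fun a b => ((Set.toFinite _).countable).union (hDc _))
  have hDF : ∀ a ∈ F, D (a.comp mulC) ⊆ F := fun a ha b hb => hF a ha a ha (Or.inr hb)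
  refine ⟨F, fun a ha => hAF (by simp [ha]), hFc, hAF (by simp), ?_, ?_, ?_, ?_, ?_, ?_⟩
  · exact fun a ha b hb => hF a ha b hb (by simp)
  · intro K hK
    obtain ⟨n, hn⟩ := (CompactExhaustion.choice G).exists_superset_of_isCompact hK
    exact ⟨χ n, hAF (by simp), hχc n, fun x hx => hχ1 n x (hn hx)⟩
  · exact fun g g' h a ha => h (a.comp inC) (hF a ha a ha (by simp))
  · exact fun p p' h1 h2 a ha => hD (a.comp mulC) p p' (h1.mono (hDF a ha)) (h2.mono (hDF a ha))
  · intro p p' h1 h2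
    have hr : D reσ ⊆ F := fun b hb => hAF (by simp [hb])
    have hi : D imσ ⊆ F := fun b hb => hAF (by simp [hb])
    exact Circle.ext (Complex.ext (hD reσ p p' (h1.mono hr) (h2.mono hr))
      (hD imσ p p' (h1.mono hi) (h2.mono hi)))
  · intro a ha hac x x' h
    have hx : ∀ x : Obj G, tgtObj x.1 = x := fun x => Subtype.ext (tgt_obj x)
    have := h (I a) (hF a ha a ha (by simp))
    rwa [hI a hac, hI a hac, hx, hx] at this

end Family

/-! ## Continuous pseudo-distances -/

/-- Continuous pseudo-distances on a topological space. -/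
structure IsPseudoDist {X : Type*} [TopologicalSpace X] (ρ : X → X → ℝ) : Prop where
  self : ∀ x, ρ x x = 0
  comm : ∀ x y, ρ x y = ρ y x
  triangle : ∀ x y z, ρ x z ≤ ρ x y + ρ y z
  continuous : Continuous fun p : X × X => ρ p.1 p.2

namespace IsPseudoDist

variable {X : Type*} [TopologicalSpace X] {ρ ρ' : X → X → ℝ}

theorem nonneg (h : IsPseudoDist ρ) (x y : X) : 0 ≤ ρ x y := by
  have h1 := h.triangle x y x
  rw [h.self, h.comm y x] at h1
  linarith

theorem add (h : IsPseudoDist ρ) (h' : IsPseudoDist ρ') :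
    IsPseudoDist fun x y => ρ x y + ρ' x y where
  self x := by rw [h.self, h'.self, add_zero]
  comm x y := by rw [h.comm, h'.comm]
  triangle x y z := by linarith [h.triangle x y z, h'.triangle x y z]
  continuous := h.continuous.add h'.continuous

theorem of_continuousMap (f : C(X, ℝ)) : IsPseudoDist fun x y => |f x - f y| where
  self x := by simp
  comm x y := abs_sub_comm _ _
  triangle x y z := abs_sub_le _ _ _
  continuous := by fun_prop

theorem min_one (h : IsPseudoDist ρ) : IsPseudoDist fun x y => min 1 (ρ x y) where
  self x := by simp [h.self]
  comm x y := by rw [h.comm]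
  triangle x y z := by
    have h1 := h.nonneg x y
    have h2 := h.nonneg y z
    have h3 := h.triangle x y z
    rcases le_total 1 (ρ x y) with h4 | h4 <;> rcases le_total 1 (ρ y z) with h5 | h5 <;>
      simp only [h4, h5, min_eq_left, min_eq_right] <;>
      linarith [min_le_left 1 (ρ x z), min_le_right 1 (ρ x z)]
  continuous := continuous_const.min h.continuous

theorem summable_geometric {τ : ℕ → X → X → ℝ} (h : ∀ n, IsPseudoDist (τ n)) (x y : X) :
    Summable fun n => (1 / 2 : ℝ) ^ n * min 1 (τ n x y) :=
  Summable.of_nonneg_of_le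
    (fun n => mul_nonneg (by positivity) ((h n).min_one.nonneg x y))
    (fun n => mul_le_of_le_one_right (by positivity) (min_le_left _ _)) summable_geometric_two

/-- The weighted sum of a sequence of truncated pseudo-distances. -/
theorem tsum_geometric {τ : ℕ → X → X → ℝ} (h : ∀ n, IsPseudoDist (τ n)) :
    IsPseudoDist fun x y => ∑' n, (1 / 2 : ℝ) ^ n * min 1 (τ n x y) where
  self x := by simp [fun n => (h n).self x]
  comm x y := by simp only [fun n => (h n).comm x y]
  triangle x y z := by
    rw [← (summable_geometric h x y).tsum_add (summable_geometric h y z)]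
    refine (summable_geometric h x z).tsum_le_tsum (fun n => ?_)
      ((summable_geometric h x y).add (summable_geometric h y z))
    rw [← mul_add]
    exact mul_le_mul_of_nonneg_left ((h n).min_one.triangle x y z) (by positivity)
  continuous := by
    refine continuous_tsum (fun n => continuous_const.mul (h n).min_one.continuous)
      summable_geometric_two fun n p => ?_
    rw [Real.norm_of_nonneg (mul_nonneg (by positivity) ((h n).min_one.nonneg _ _))]
    exact mul_le_of_le_one_right (by positivity) (min_le_left _ _)

theorem le_tsum_geometric {τ : ℕ → X → X → ℝ} (h : ∀ n, IsPseudoDist (τ n)) (n : ℕ) (x y : X) :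
    (1 / 2 : ℝ) ^ n * min 1 (τ n x y) ≤ ∑' n, (1 / 2 : ℝ) ^ n * min 1 (τ n x y) :=
  (summable_geometric h x y).le_tsum n
    fun m _ => mul_nonneg (by positivity) ((h m).min_one.nonneg x y)

/-- The sum of the pseudo-distances of a locally finite family of functions. -/
theorem finsum_of_locallyFinite {ι : Type*} (f : ι → C(X, ℝ))
    (hf : LocallyFinite fun i => Function.support (f i)) :
    IsPseudoDist fun x y => ∑ᶠ i, |f i x - f i y| := by
  have hfin : ∀ x y, (Function.support fun i => |f i x - f i y|).Finite := by
    intro x y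
    refine ((hf.point_finite x).union (hf.point_finite y)).subset fun i hi => ?_
    by_contra hn
    simp only [mem_union, mem_ofPred_eq, Function.mem_support, not_or, not_not] at hn
    exact hi (by simp [hn.1, hn.2])
  refine ⟨fun x => by simp, fun x y => by simp only [abs_sub_comm], fun x y z => ?_, ?_⟩
  · rw [← finsum_add_distrib (hfin x y) (hfin y z)]
    refine finsum_le_finsum' (hfin x z) ?_ fun i => abs_sub_le _ _ _
    exact ((hfin x y).union (hfin y z)).subset (Function.support_add _ _)
  · refine continuous_finsum (fun i => by fun_prop) ?_
    rintro ⟨x, y⟩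
    obtain ⟨U, hU, hUf⟩ := hf x
    obtain ⟨V, hV, hVf⟩ := hf y
    refine ⟨U ×ˢ V, prod_mem_nhds hU hV, (hUf.union hVf).subset ?_⟩
    rintro i ⟨⟨a, b⟩, hi, ha, hb⟩
    by_cases hfa : f i a = 0
    · by_cases hfb : f i b = 0
      · exact absurd (by simp [hfa, hfb]) hi
      · exact Or.inr ⟨b, hfb, hb⟩
    · exact Or.inl ⟨a, hfa, ha⟩

/-- An open cover has a continuous pseudo-distance, depending on countably many functions, whose
unit balls refine it. -/
theorem exists_of_isOpenCovering [T2Space X] [LocallyCompactSpace X] [SigmaCompactSpace X]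
    {𝒲 : Set (Set X)} (h𝒲 : IsOpenCovering 𝒲) :
    ∃ (ρ : X → X → ℝ) (A : Set C(X, ℝ)), IsPseudoDist ρ ∧ A.Countable ∧
      (∀ x y, AgreeOn A x y → ρ x y = 0) ∧ ∀ x, ∃ W ∈ 𝒲, ∀ y, ρ x y < 1 → y ∈ W := by
  obtain ⟨f, hf⟩ := BumpCovering.exists_isSubordinate (X := X) isClosed_univ
    (fun W : 𝒲 => W.1) (fun W => h𝒲.1 W.1 W.2) (by rw [← sUnion_eq_iUnion, h𝒲.2])
  have hρ := finsum_of_locallyFinite (fun i => f i) f.locallyFinite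
  let J : Set 𝒲 := {i | (Function.support (f i)).Nonempty}
  -- A locally finite family of nonempty sets in a σ-compact space is countable, so only countably
  -- many bumps are nonzero.
  have hJ : J.Countable := by
    have hl : LocallyFinite fun i : J => Function.support (f i.1) :=
      f.locallyFinite.comp_injective Subtype.val_injective
    rw [← countable_coe_iff, ← countable_univ_iff]
    exact hl.countable_univ fun i => i.2
  refine ⟨_, (fun i => f i) '' J, hρ, hJ.image _, ?_, ?_⟩
  · intro x y h
    refine finsum_eq_zero_of_forall_eq_zero fun i => ?_
    by_cases hi : i ∈ J
    · rw [h (f i) ⟨i, hi, rfl⟩, sub_self, abs_zero]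
    · have h0 : ∀ z, f i z = 0 := fun z => by
        by_contra hz
        exact hi ⟨z, hz⟩
      simp [h0]
  · intro x
    -- The bump indexed by `f.ind x` equals `1` at `x`. If it vanished at `y`, its term alone would
    -- make the distance at least `1`.
    refine ⟨_, (f.ind x (mem_univ x)).2, fun y hy => ?_⟩
    refine hf _ (subset_tsupport _ fun h0 => ?_)
    have hle : |f (f.ind x (mem_univ x)) x - f (f.ind x (mem_univ x)) y| ≤ ∑ᶠ i, |f i x - f i y| := by
      refine single_le_finsum (f := fun i => |f i x - f i y|) _ ?_ fun _ => abs_nonneg _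
      refine ((f.point_finite x).union (f.point_finite y)).subset fun i hi => ?_
      by_contra hn
      simp only [mem_union, mem_ofPred_eq, not_or, not_not] at hn
      exact hi (by simp [hn.1, hn.2])
    rw [f.ind_apply, h0] at hle
    simp at hle
    linarith

end IsPseudoDist

/-! ## Proper quotients -/

/-- The image of `L` is a compact neighbourhood of `y`. A compact set in `Y` is covered by finitely
many such `U`, so its preimage is closed in a finite union of compact sets. -/
theorem isProperMap_of_locally_subset_isCompact {X Y : Type*} [TopologicalSpace X]
    [TopologicalSpace Y] [T2Space Y] {q : X → Y} (hc : Continuous q) (hs : Function.Surjective q)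
    (h : ∀ y, ∃ U ∈ 𝓝 y, ∃ L, IsCompact L ∧ q ⁻¹' U ⊆ L) :
    LocallyCompactSpace Y ∧ IsProperMap q := by
  have hw : WeaklyLocallyCompactSpace Y := ⟨fun y => by
    obtain ⟨U, hU, L, hL, hUL⟩ := h y
    refine ⟨q '' L, hL.image hc, Filter.mem_of_superset hU fun z hz => ?_⟩
    obtain ⟨x, rfl⟩ := hs z
    exact ⟨x, hUL hz, rfl⟩⟩
  refine ⟨inferInstance, isProperMap_iff_isCompact_preimage.mpr ⟨hc, fun K hK => ?_⟩⟩
  have : ∃ L, IsCompact L ∧ q ⁻¹' K ⊆ L := by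
    refine hK.induction_on (p := fun s => ∃ L, IsCompact L ∧ q ⁻¹' s ⊆ L)
      ⟨∅, isCompact_empty, by simp⟩ ?_ ?_ ?_
    · rintro s t hst ⟨L, hL, htL⟩
      exact ⟨L, hL, (preimage_mono hst).trans htL⟩
    · rintro s t ⟨L, hL, hsL⟩ ⟨M, hM, htM⟩
      exact ⟨L ∪ M, hL.union hM, union_subset_union hsL htM⟩
    · intro y _
      obtain ⟨U, hU, hL⟩ := h y
      exact ⟨U, mem_nhdsWithin_of_mem_nhds hU, hL⟩
  obtain ⟨L, hL, hKL⟩ := this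
  exact hL.of_isClosed_subset (hK.isClosed.preimage hc) hKL

/-- Measures that agree on a multiplicative family of functions inducing `q` have the same image
under `q`. -/
theorem map_eq_of_integral_eq {X Y : Type*} [TopologicalSpace X] [MeasurableSpace X]
    [BorelSpace X] [TopologicalSpace Y] [T2Space Y] [LocallyCompactSpace Y] [MeasurableSpace Y]
    [BorelSpace Y] {q : X → Y} (hq : IsProperMap q) (hs : Function.Surjective q)
    {F : Set C(X, ℝ)} (h1 : 1 ∈ F) (hmul : ∀ a ∈ F, ∀ b ∈ F, a * b ∈ F)
    (hex : ∀ K : Set X, IsCompact K → ∃ χ ∈ F, HasCompactSupport χ ∧ ∀ x ∈ K, χ x = 1)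
    (hF : ∀ a ∈ F, ∃ b : C(Y, ℝ), ∀ x, b (q x) = a x) (hsep : ∀ x y, AgreeOn F x y → q x = q y)
    {m m' : Measure X} [IsFiniteMeasureOnCompacts m] [IsFiniteMeasureOnCompacts m']
    [(m.map q).Regular] [(m'.map q).Regular]
    (hm : ∀ a ∈ F, HasCompactSupport a → ∫ x, a x ∂m = ∫ x, a x ∂m') :
    m.map q = m'.map q := by
  let qc : C(X, Y) := ⟨q, hq.continuous⟩
  let S : Submonoid C(Y, ℝ) :=
    { carrier := {b | b.comp qc ∈ F}
      one_mem' := h1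
      mul_mem' := fun {b c} hb hc => hmul _ hb _ hc }
  have hA : (Algebra.adjoin ℝ (S : Set C(Y, ℝ))).SeparatesPoints := by
    intro z w hzw
    obtain ⟨x, rfl⟩ := hs z
    obtain ⟨y, rfl⟩ := hs w
    have : ¬ AgreeOn F x y := fun h => hzw (hsep x y h)
    simp only [AgreeOn, not_forall] at this
    obtain ⟨a, ha, hxy⟩ := this
    obtain ⟨b, hb⟩ := hF a ha
    refine ⟨_, ⟨b, Algebra.subset_adjoin ?_, rfl⟩,
      fun e => hxy (by rw [← hb, ← hb]; exact e)⟩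
    have : b.comp qc = a := ContinuousMap.ext hb
    exact (show b.comp qc ∈ F by rwa [this])
  refine Measure.ext_of_integral_eq_on_compactlySupported fun φ => ?_
  rw [integral_map hq.continuous.measurable.aemeasurable
      (map_continuous φ).measurable.aestronglyMeasurable,
    integral_map hq.continuous.measurable.aemeasurable
      (map_continuous φ).measurable.aestronglyMeasurable]
  -- The approximants of `φ` need not have compact support; multiplication by `χ` makes their
  -- pullbacks integrable and leaves `φ ∘ q` unchanged.
  obtain ⟨χ, hχF, hχc, hχ1⟩ := hex _ (hq.isCompact_preimage φ.hasCompactSupport.isCompact)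
  have hφχ : ∀ x, φ (q x) = φ (q x) * χ x := by
    intro x
    by_cases hx : q x ∈ tsupport φ
    · rw [hχ1 x hx, mul_one]
    · rw [image_eq_zero_of_notMem_tsupport hx, zero_mul]
  have hcs : ∀ b : C(Y, ℝ), HasCompactSupport fun x => b (q x) * χ x := fun b =>
    hχc.mul_left (f := fun x => b (q x))
  have hi : ∀ (b : C(Y, ℝ)) (n : Measure X) [IsFiniteMeasureOnCompacts n],
      Integrable (fun x => b (q x) * χ x) n := fun b n _ =>
    ((b.continuous.comp hq.continuous).mul χ.continuous).integrable_of_hasCompactSupport (hcs b)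
  have hiφ : ∀ (n : Measure X) [IsFiniteMeasureOnCompacts n],
      Integrable (fun x => φ (q x) * χ x) n := fun n _ => hi φ.toContinuousMap n
  have hχi : ∀ (n : Measure X) [IsFiniteMeasureOnCompacts n], Integrable (fun x => |χ x|) n :=
    fun n _ => (χ.continuous.integrable_of_hasCompactSupport hχc).abs
  have halg : ∀ b ∈ Algebra.adjoin ℝ (S : Set C(Y, ℝ)),
      ∫ x, b (q x) * χ x ∂m = ∫ x, b (q x) * χ x ∂m' := by
    intro b hb
    -- Since `S` is closed under products, the algebra it generates is its linear span, and
    -- linearity reduces the claim to members of `F`.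
    rw [← Subalgebra.mem_toSubmodule, Algebra.adjoin_eq_span, Submonoid.closure_eq] at hb
    induction hb using Submodule.span_induction with
    | mem b hb => exact hm _ (hmul _ hb _ hχF) (hcs b)
    | zero => simp
    | add b c _ _ hb hc =>
      simp only [ContinuousMap.add_apply, add_mul]
      rw [integral_add (hi b m) (hi c m), integral_add (hi b m') (hi c m'), hb, hc]
    | smul r b _ hb =>
      simp only [ContinuousMap.smul_apply, smul_eq_mul, mul_assoc]
      rw [integral_const_mul, integral_const_mul, hb]
  have hclose : ∀ (b : C(Y, ℝ)) (ε : ℝ), (∀ y ∈ q '' tsupport χ, ‖b y - φ y‖ < ε) →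
      ∀ (n : Measure X) [IsFiniteMeasureOnCompacts n],
      |∫ x, b (q x) * χ x ∂n - ∫ x, φ (q x) * χ x ∂n| ≤ ε * ∫ x, |χ x| ∂n := by
    intro b ε hb n _
    rw [← integral_sub (hi b n) (hiφ n), ← Real.norm_eq_abs, ← integral_const_mul]
    refine norm_integral_le_of_norm_le ((hχi n).const_mul ε) (Filter.Eventually.of_forall ?_)
    intro x
    change ‖b (q x) * χ x - φ (q x) * χ x‖ ≤ ε * |χ x|
    rw [← sub_mul, norm_mul, Real.norm_eq_abs (χ x)]
    by_cases hx : x ∈ tsupport χ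
    · exact mul_le_mul_of_nonneg_right (hb _ ⟨x, hx, rfl⟩).le (abs_nonneg _)
    · simp [image_eq_zero_of_notMem_tsupport hx]
  have hint : ∀ n : Measure X, ∫ x, φ (q x) ∂n = ∫ x, φ (q x) * χ x ∂n := fun n =>
    integral_congr_ae (ae_of_all _ hφχ)
  rw [hint m, hint m']
  set C := (∫ x, |χ x| ∂m) + ∫ x, |χ x| ∂m' with hC
  have hC0 : 0 ≤ C := add_nonneg (integral_nonneg fun _ => abs_nonneg _)
    (integral_nonneg fun _ => abs_nonneg _)
  refine eq_of_abs_sub_le_all fun ε hε => ?_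
  -- The two approximation errors add up to `ε / (C + 1) * C`; the `+ 1` keeps the denominator
  -- positive when `C = 0`.
  obtain ⟨b, hbA, hb⟩ :=
    ContinuousMap.exists_mem_subalgebra_near_continuous_of_isCompact_of_separatesPoints hA
      φ.toContinuousMap (hχc.isCompact.image hq.continuous)
      (show 0 < ε / (C + 1) by positivity)
  have e1 := hclose b _ hb m
  have e2 := hclose b _ hb m'
  rw [halg b hbA] at e1
  have e3 : ε / (C + 1) * C ≤ ε := by
    rw [div_mul_eq_mul_div, div_le_iff₀ (by positivity)]
    nlinarith
  rw [hC, mul_add] at e3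
  rw [abs_le] at e1 e2 ⊢
  constructor <;> linarith [e1.1, e1.2, e2.1, e2.2]

/-! ## The pseudo-metric of a family of functions -/

section Metric

variable {G : Type*} [TopologicalSpace G]

/-- A continuous pseudo-metric whose zero relation is agreement on `F`, and for which the members
of `F` are continuous. -/
structure IsFamilyMetric (d : PseudoMetricSpace G) (F : Set C(G, ℝ)) : Prop where
  continuous_toPseudo : Continuous (toPseudo d)
  dist_eq_zero : ∀ x y : G, d.dist x y = 0 ↔ AgreeOn F x y
  continuous_fun : ∀ f ∈ F, Continuous fun x : WithPseudoMetric d => f x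

namespace IsFamilyMetric

variable {d : PseudoMetricSpace G} {F : Set C(G, ℝ)} (h : IsFamilyMetric d F)
include h

theorem continuous_quotMap : Continuous (quotMap d) :=
  SeparationQuotient.continuous_mk.comp h.continuous_toPseudo

omit [TopologicalSpace G] h in
theorem quotMap_surjective : Function.Surjective (quotMap d) :=
  SeparationQuotient.surjective_mk

theorem quotMap_eq_iff (x y : G) : quotMap d x = quotMap d y ↔ AgreeOn F x y := by
  rw [← h.dist_eq_zero]
  exact SeparationQuotient.mk_eq_mk.trans Metric.inseparable_iff

theorem exists_descend (f : C(G, ℝ)) (hf : f ∈ F) :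
    ∃ b : C(MetricQuotient d, ℝ), ∀ x, b (quotMap d x) = f x := by
  have hc := h.continuous_fun f hf
  exact ⟨⟨SeparationQuotient.lift (fun x : WithPseudoMetric d => f x)
    fun x y hxy => (hxy.map hc).eq, SeparationQuotient.continuous_lift hc⟩, fun x => rfl⟩

/-- A cutoff in `F` with value `1` at `x` descends to a continuous function on the quotient. The set
where that function is nonzero is a neighbourhood of the class of `x` whose preimage lies in the
compact support of the cutoff. -/
theorem locallyCompactSpace_and_isProperMap
    (hex : ∀ K : Set G, IsCompact K → ∃ χ ∈ F, HasCompactSupport χ ∧ ∀ x ∈ K, χ x = 1) :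
    LocallyCompactSpace (MetricQuotient d) ∧ IsProperMap (quotMap d) := by
  refine isProperMap_of_locally_subset_isCompact h.continuous_quotMap quotMap_surjective
    fun z => ?_
  obtain ⟨x, rfl⟩ := quotMap_surjective z
  obtain ⟨χ, hχF, hχc, hχ1⟩ := hex {x} isCompact_singleton
  obtain ⟨b, hb⟩ := h.exists_descend χ hχF
  refine ⟨b ⁻¹' {0}ᶜ, ?_, tsupport χ, hχc, fun y hy => subset_tsupport _ ?_⟩
  · refine b.continuous.continuousAt (isOpen_compl_singleton.mem_nhds ?_)
    simp [hb, hχ1 x rfl]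
  · have hy : b (quotMap d y) ≠ 0 := hy
    rwa [hb] at hy

theorem isProperCont_metricProj (hp : IsProperMap (quotMap d)) : IsProperCont (metricProj d) := by
  refine ⟨SeparationQuotient.continuous_mk, fun K _ hK => ?_⟩
  exact (hp.isCompact_preimage hK).image h.continuous_toPseudo |>.of_isClosed_subset
    (hK.isClosed.preimage SeparationQuotient.continuous_mk) fun x hx => ⟨x, hx, rfl⟩

theorem isProperCont_toPseudo (hp : IsProperMap (quotMap d)) : IsProperCont (toPseudo d) := by
  refine ⟨h.continuous_toPseudo, fun K hKc hK => ?_⟩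
  exact (hp.isCompact_preimage (hK.image SeparationQuotient.continuous_mk)).of_isClosed_subset
    (hKc.preimage h.continuous_toPseudo) fun x hx => ⟨x, hx, rfl⟩

end IsFamilyMetric

theorem exists_isFamilyMetric {F : Set C(G, ℝ)} (hF : F.Countable) (hne : F.Nonempty)
    {ρ : ℕ → G → G → ℝ} (hρ : ∀ n, IsPseudoDist (ρ n))
    (hρF : ∀ n x y, AgreeOn F x y → ρ n x y = 0) :
    ∃ d : PseudoMetricSpace G, IsFamilyMetric d F ∧
      ∀ n x y, d.dist x y < 1 / 2 ^ n → ρ n x y < 1 := by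
  obtain ⟨f, rfl⟩ := hF.exists_eq_range hne
  -- One summand serves two purposes: `ρ n` controls the balls, while `f n` makes distance zero
  -- imply agreement on `F`.
  let τ : ℕ → G → G → ℝ := fun n x y => ρ n x y + |f n x - f n y|
  have hτ : ∀ n, IsPseudoDist (τ n) := fun n => (hρ n).add (IsPseudoDist.of_continuousMap (f n))
  have hd := IsPseudoDist.tsum_geometric hτ
  let d : PseudoMetricSpace G :=
    { dist := fun x y => ∑' n, (1 / 2 : ℝ) ^ n * min 1 (τ n x y)
      dist_self := hd.self
      dist_comm := hd.comm
      dist_triangle := hd.triangle }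
  have hle : ∀ n x y, (1 / 2 : ℝ) ^ n * min 1 (τ n x y) ≤ d.dist x y :=
    IsPseudoDist.le_tsum_geometric hτ
  -- The bound `ε ≤ 1` is needed because a summand is truncated at `1` and carries no information
  -- beyond that.
  have hlt : ∀ n x y, ∀ ε ≤ (1 : ℝ), d.dist x y < (1 / 2) ^ n * ε → τ n x y < ε := by
    intro n x y ε hε hxy
    have h1 := lt_of_mul_lt_mul_left ((hle n x y).trans_lt hxy) (by positivity)
    rcases min_lt_iff.mp h1 with h2 | h2
    · linarith
    · exact h2
  refine ⟨d, ⟨?_, ?_, ?_⟩, ?_⟩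
  · rw [continuous_iff_continuousAt]
    intro x
    rw [ContinuousAt, tendsto_iff_dist_tendsto_zero]
    have hc : Continuous fun y => d.dist y x :=
      hd.continuous.comp (continuous_id.prodMk continuous_const)
    have := hc.tendsto x
    rwa [d.dist_self] at this
  · intro x y
    constructor
    · rintro hxy _ ⟨n, rfl⟩
      have h0 : τ n x y ≤ 0 := by
        by_contra! hpos
        have h1 := hle n x y
        rw [hxy] at h1
        have : 0 < (1 / 2 : ℝ) ^ n * min 1 (τ n x y) :=
          mul_pos (by positivity) (lt_min one_pos hpos)
        linarith
      have h1 : |f n x - f n y| ≤ 0 := by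
        have := (hρ n).nonneg x y
        simp only [τ] at h0
        linarith
      exact sub_eq_zero.mp (abs_nonpos_iff.mp h1)
    · intro hxy
      have h0 : ∀ n, τ n x y = 0 := fun n => by
        simp [τ, hρF n x y hxy, hxy (f n) ⟨n, rfl⟩]
      change ∑' n, (1 / 2 : ℝ) ^ n * min 1 (τ n x y) = 0
      simp [h0]
  · rintro _ ⟨n, rfl⟩
    rw [Metric.continuous_iff]
    intro x ε hε
    refine ⟨(1 / 2) ^ n * min 1 ε, by positivity, fun y hy => ?_⟩
    have h1 := hlt n y x _ (min_le_left 1 ε) hy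
    have h2 := (hρ n).nonneg y x
    have h3 := min_le_right 1 ε
    simp only [τ] at h1
    rw [Real.dist_eq]
    linarith
  · intro n x y hxy
    have h1 := hlt n x y 1 le_rfl (by simpa using hxy)
    have h2 := abs_nonneg (f n x - f n y)
    simp only [τ] at h1
    linarith

end Metric

/-! ### Assembly of the theorem -/

theorem mainTheorem6 {G : Type*} [TopologicalSpace G] [MeasurableSpace G] [BorelSpace G]
    [ArrowGroupoid G] [IsTopGroupoid G] [SigmaCompactSpace G]
    (μ : HaarSystem G) (σ : TwoCocycle G)
    (W0 : ℕ → Set (Set (Obj G))) (W1 : ℕ → Set (Set G))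
    (hW0 : IsNormalSeq W0) (hW1 : IsNormalSeq W1) :
    ∃ (d : PseudoMetricSpace G) (_ : ArrowGroupoid (MetricQuotient d))
      (_ : IsTopGroupoid (MetricQuotient d)) (hom : IsHom (quotMap d))
      (proper : IsProperCont (quotMap d))
      (μα : HaarSystem (MetricQuotient d)) (σα : TwoCocycle (MetricQuotient d)),
      SecondCountableTopology (MetricQuotient d) ∧
      IsProperCont (toPseudo d) ∧ IsProperCont (metricProj d) ∧
      (∀ (n : ℕ) (z : MetricQuotient d), ∃ W ∈ W1 n,
        quotMap d ⁻¹' Metric.ball z (1 / 2 ^ n) ⊆ W) ∧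
      (∀ (n : ℕ) (z : Obj (MetricQuotient d)), ∃ W ∈ W0 n,
        hom.obj ⁻¹' Metric.ball z (1 / 2 ^ n) ⊆ W) ∧
      HaarPreserving hom μ μα ∧
      CocyclePreserving hom σ σα ∧
      IsStarMorphism μα σα μ σ (pullback proper) := by
  have hsrc : Continuous (srcObj : G → Obj G) := Continuous.subtype_mk continuous_src _
  -- Pulling the covers of the unit space back along the source lets functions on `G` control both
  -- sequences of covers.
  have hcov : ∀ n, IsOpenCovering ((fun W => (srcObj : G → Obj G) ⁻¹' W) '' W0 n) := by
    intro n
    refine ⟨?_, eq_univ_of_forall fun g => ?_⟩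
    · rintro _ ⟨W, hW, rfl⟩
      exact ((hW0.1 n).1 W hW).preimage hsrc
    · have hg : srcObj g ∈ ⋃₀ W0 n := by rw [(hW0.1 n).2]; trivial
      obtain ⟨W, hW, hgW⟩ := hg
      exact ⟨_, ⟨W, hW, rfl⟩, hgW⟩
  choose ρ₁ A₁ hρ₁ hA₁ hAρ₁ hball₁ using
    fun n => IsPseudoDist.exists_of_isOpenCovering (hW1.1 n)
  choose ρ₀ A₀ hρ₀ hA₀ hAρ₀ hball₀ using
    fun n => IsPseudoDist.exists_of_isOpenCovering (hcov n)
  obtain ⟨F, hAF, hF⟩ := exists_isInvariantFamily μ σ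
    ((countable_iUnion hA₁).union (countable_iUnion hA₀))
  have hA₁F : ∀ n, A₁ n ⊆ F := fun n =>
    ((subset_iUnion A₁ n).trans subset_union_left).trans hAF
  have hA₀F : ∀ n, A₀ n ⊆ F := fun n =>
    ((subset_iUnion A₀ n).trans subset_union_right).trans hAF
  -- Both summands are nonnegative, so their sum being below `1` bounds each of them by `1`.
  obtain ⟨d, hd, hdρ⟩ := exists_isFamilyMetric hF.countable ⟨1, hF.one_mem⟩
    (fun n => (hρ₁ n).add (hρ₀ n)) (fun n x y h => by
      rw [hAρ₁ n x y (h.mono (hA₁F n)), hAρ₀ n x y (h.mono (hA₀F n)), add_zero])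
  obtain ⟨hlc, hproper⟩ := hd.locallyCompactSpace_and_isProperMap hF.exhausting
  have hsurj : Function.Surjective (quotMap d) := IsFamilyMetric.quotMap_surjective
  -- For a metric space σ-compactness gives second countability; it also gives regularity of the
  -- pushed-forward measures.
  have hσc : SigmaCompactSpace (MetricQuotient d) :=
    ⟨by rw [← hsurj.range_eq]; exact isSigmaCompact_range hproper.continuous⟩
  have hlf : ∀ x, IsLocallyFiniteMeasure ((μ.meas x).map (quotMap d)) := by
    intro x
    have := μ.regular x
    exact hproper.isLocallyFiniteMeasure_map _
  have hq : IsHaarQuotient μ (quotMap d) :=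
    { proper := hproper
      surjective := hsurj
      inv_congr := fun g g' h => by
        rw [hd.quotMap_eq_iff] at h ⊢
        exact hF.inv_agree g g' h
      mul_congr := fun g h g' h' e e' hg hh => by
        rw [hd.quotMap_eq_iff] at hg hh ⊢
        exact hF.mul_agree ⟨(g, h), e⟩ ⟨(g', h'), e'⟩ hg hh
      map_congr := fun x x' h => by
        rw [hd.quotMap_eq_iff] at h
        have := μ.regular x
        have := μ.regular x'
        have := hlf x
        have := hlf x'
        exact map_eq_of_integral_eq hproper hsurj hF.one_mem hF.mul_mem hF.exhausting
          hd.exists_descend (fun x y => (hd.quotMap_eq_iff x y).mpr)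
          fun a ha hac => hF.integral_eq a ha hac x x' h }
  have hσ : ∀ p p' : Comp G, quotMap d p.1.1 = quotMap d p'.1.1 →
      quotMap d p.1.2 = quotMap d p'.1.2 → σ.toFun p = σ.toFun p' := by
    intro p p' h1 h2
    rw [hd.quotMap_eq_iff] at h1 h2
    exact hF.cocycle_eq p p' h1 h2
  let _ := hq.groupoid
  have := hq.isTopGroupoid
  refine ⟨d, hq.groupoid, hq.isTopGroupoid, hq.isHom, hq.isProperCont, hq.haarSystem,
    hq.cocycle hσ, inferInstance, hd.isProperCont_toPseudo hproper,
    hd.isProperCont_metricProj hproper, ?_, ?_, hq.haarPreserving, hq.cocyclePreserving hσ,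
    isStarMorphism_pullback _ _ hq.haarPreserving (hq.cocyclePreserving hσ)⟩
  · intro n z
    obtain ⟨x, rfl⟩ := hsurj z
    obtain ⟨W, hW, hxW⟩ := hball₁ n x
    refine ⟨W, hW, fun y hy => hxW y ?_⟩
    have h1 := hdρ n x y ((d.dist_comm x y).trans_lt hy)
    have h2 := (hρ₀ n).nonneg x y
    linarith
  · intro n z
    obtain ⟨x, rfl⟩ := hq.isHom.obj_surjective hsurj z
    obtain ⟨_, ⟨W, hW, rfl⟩, hxW⟩ := hball₀ n x.1
    refine ⟨W, hW, fun y hy => ?_⟩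
    have h1 := hdρ n x.1 y.1 ((d.dist_comm x.1 y.1).trans_lt hy)
    have h2 := (hρ₁ n).nonneg x.1 y.1
    have h3 : srcObj y.1 ∈ W := hxW y.1 (by linarith)
    -- The pulled-back cover restricts to the original one on units, because a unit is its own
    -- source.
    have h4 : srcObj y.1 = y := Subtype.ext y.2
    rwa [h4] at h3
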